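/- **Setting.** Let $U\subset\mathbb R^3$ be open and simply connected (in particular connected) and let $f:U\to\mathbb R^3$ be a smooth triply orthogonal system: $\det(\partial_1f,\partial_2f,\partial_3f)\neq0$ and $(\partial_if,\partial_jf)=0$ for $i\ne j$. For $(i,j,k)$ a cyclic permutation of $(1,2,3)$ let $N_i=\frac{\partial_jf\times\partial_kf}{|\partial_jf\times\partial_kf|}$ be the unit normal of the coordinate surfaces $x_i=const$, and let the Lamé coefficients $H_i$ be given by $\partial_if=H_iN_i$. For $i\neq j$ let $\kappa_{ij}$ be the principal curvature of the surface $x_i=const$ along the $x_j$-lines (which are curvature lines), $\kappa_{ij}=(\partial_j^2f,N_i)/|\partial_jf|^2$. Suppose that $f$ is a *Guichard net*, that is, $H_1^2+H_2^2-H_3^2=0$, and put $(\varepsilon_1,\varepsilon_2,\varepsilon_3)=(1,1,-1)$. An *associated system* of $f$ is a smooth map $\hat f:U\to\mathbb R^3$ with $$d\hat f=h_1\,\partial_1f\,dx_1+h_2\,\partial_2f\,dx_2+h_3\,\partial_3f\,dx_3,\qquad h_j-h_i=\frac{\varepsilon_kH_k}{H_iH_j}\quad\text{for }(i,j,k)\text{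 cyclic},$$ for some functions $h_1,h_2,h_3:U\to\mathbb R$, i.e. a Combescure transform of $f$ whose Lamé coefficients $\hat H_i=h_iH_i$ satisfy $H_i\hat H_j-H_j\hat H_i=\varepsilon_kH_k$. (The functions $h_i$ may have zeros, where $\hat f$ degenerates. Up to translations the associated systems form a one-parameter family $\hat f_0+cf$, $c\in\mathbb R$.) The coordinate surfaces $x_i=const$ are *parallel* if, locally, any two of them are related by moving one along its unit normals $N_i$ by a distance that is the same for all of its points, points with equal $x_j,x_k$ corresponding to each other. They are *totally umbilic* if $\kappa_{ij}=\kappa_{ik}$ on $U$. A system $\hat f$ is *cyclic* if two of its coordinate surface families consist of channel surfaces with a common circular direction: there is an index $i$ such that for both $j\neq i$ the surfaces $x_j=const$ of $\hat f$ are, at all points where they are immersed, channel surfaces along the $x_i$-lines, that is, their principal curvature $\hat\kappa_{ji}$ in the direction of the $x_i$-lines satisfies $\partial_i\hat\kappa_{ji}=0$. **Proposition.** For some $i\in\{1,2,3\}$ the coordinate surfaces $x_i=const$ of the Guichard net $f$ are parallel or totally umbilic if and only if all associated systems of $f$ are cyclic. -/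

import Mathlib

open scoped ContDiff InnerProductSpace

namespace GuichardNet

/-- Euclidean three-space, used both for the parameter domain and for the target.
The coordinates `x₁, x₂, x₃` carry the indices `0, 1, 2 : Fin 3`; since `Fin 3` is cyclic,
`(i, i + 1, i + 2)` is always a cyclic permutation of `(0, 1, 2)`. -/
abbrev E3 : Type := EuclideanSpace ℝ (Fin 3)

/-- The partial derivative `∂ᵢ g` at `p`. -/
noncomputable def pd {F : Type*} [NormedAddCommGroup F] [NormedSpace ℝ F]
    (i : Fin 3) (g : E3 → F) (p : E3) : F :=
  fderiv ℝ g p (EuclideanSpace.single i (1 : ℝ))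

/-- The cross product of Euclidean three-space. -/
noncomputable def cross (a b : E3) : E3 :=
  WithLp.toLp 2 (crossProduct (WithLp.ofLp a) (WithLp.ofLp b))

/-- The vector `∂ⱼ g × ∂ₖ g`, `(i, j, k)` cyclic, normal to the surface `xᵢ = const`. -/
noncomputable def normalVector (g : E3 → E3) (i : Fin 3) (p : E3) : E3 :=
  cross (pd (i + 1) g p) (pd (i + 2) g p)

/-- The unit normal `Nᵢ` of the coordinate surface `xᵢ = const` of `g`. -/
noncomputable def unitNormal (g : E3 → E3) (i : Fin 3) (p : E3) : E3 :=
  ‖normalVector g i p‖⁻¹ • normalVector g i p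

/-- The Lamé coefficient `Hᵢ`, determined by `∂ᵢ f = Hᵢ Nᵢ`. -/
noncomputable def lame (f : E3 → E3) (i : Fin 3) (p : E3) : ℝ :=
  ⟪pd i f p, unitNormal f i p⟫_ℝ

/-- A (smooth) triply orthogonal system on `U`. -/
structure IsTriplyOrthogonal (U : Set E3) (f : E3 → E3) : Prop where
  smooth : ContDiffOn ℝ ∞ f U
  det_ne_zero : ∀ p ∈ U, (Matrix.of fun i j : Fin 3 => pd j f p i).det ≠ 0
  orthogonal : ∀ p ∈ U, ∀ i j : Fin 3, i ≠ j → ⟪pd i f p, pd j f p⟫_ℝ = 0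

/-- A Guichard net: a triply orthogonal system with `H₁² + H₂² - H₃² = 0`. -/
structure IsGuichardNet (U : Set E3) (f : E3 → E3) : Prop
    extends IsTriplyOrthogonal U f where
  guichard : ∀ p ∈ U, lame f 0 p ^ 2 + lame f 1 p ^ 2 - lame f 2 p ^ 2 = 0

/-- The signs `(ε₁, ε₂, ε₃) = (1, 1, -1)`. -/
def sign : Fin 3 → ℝ := ![1, 1, -1]

/-- `fhat` is an associated system of the Guichard net `f`: a Combescure transform
`d fhat = h₁ ∂₁f dx₁ + h₂ ∂₂f dx₂ + h₃ ∂₃f dx₃` of `f` whose factors satisfy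
`hⱼ - hᵢ = εₖ Hₖ / (Hᵢ Hⱼ)` for `(i, j, k)` cyclic. With `Ĥᵢ = hᵢ Hᵢ` this is
`Hᵢ Ĥⱼ - Hⱼ Ĥᵢ = εₖ Hₖ`. The factors `hᵢ` may have zeros, where `fhat` degenerates. -/
def IsAssociatedSystem (U : Set E3) (f fhat : E3 → E3) : Prop :=
  ContDiffOn ℝ ∞ fhat U ∧
    ∃ h : Fin 3 → E3 → ℝ, ∀ p ∈ U, ∀ i : Fin 3,
      pd i fhat p = h i p • pd i f p ∧
      h (i + 1) p - h i p = sign (i + 2) * lame f (i + 2) p / (lame f i p * lame f (i + 1) p)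

/-- The principal curvature `κᵢⱼ` of the surface `xᵢ = const` of `g` in the direction of the
`xⱼ`-lines (`j ≠ i`), as quotient of the second by the first fundamental form. The coordinate
lines of the systems considered here are curvature lines, by Dupin's theorem. -/
noncomputable def principalCurvature (g : E3 → E3) (i j : Fin 3) (p : E3) : ℝ :=
  ⟪pd j (pd j g) p, unitNormal g i p⟫_ℝ / ‖pd j g p‖ ^ 2

/-- The surfaces `xᵢ = const` of `f` are (locally) parallel: the surface `xᵢ = b` arises from
the surface `xᵢ = a` by moving, along its unit normals, by a distance `t a b` that does not depend
on the point of the surface. -/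
def IsParallelFamily (U : Set E3) (f : E3 → E3) (i : Fin 3) : Prop :=
  ∀ p ∈ U, ∃ r > 0, Metric.ball p r ⊆ U ∧ ∃ t : ℝ → ℝ → ℝ,
    ∀ q ∈ Metric.ball p r, ∀ q' ∈ Metric.ball p r, (∀ j, j ≠ i → q' j = q j) →
      f q' = f q + t (q i) (q' i) • unitNormal f i q

/-- The surfaces `xᵢ = const` of `f` are totally umbilic. -/
def IsTotallyUmbilicFamily (U : Set E3) (f : E3 → E3) (i : Fin 3) : Prop :=
  ∀ p ∈ U, principalCurvature f i (i + 1) p = principalCurvature f i (i + 2) p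

/-- The surfaces `xⱼ = const` of `g` are channel surfaces with circular direction `xᵢ`: wherever
they are immersed, their principal curvature in the direction of the `xᵢ`-lines is constant
along these lines. -/
def IsChannelFamily (U : Set E3) (g : E3 → E3) (j i : Fin 3) : Prop :=
  ∀ p ∈ U, normalVector g j p ≠ 0 → pd i (principalCurvature g j i) p = 0

/-- The system `g` is cyclic: for some `i`, the two coordinate surface families that contain the
`xᵢ`-lines consist of channel surfaces with circular direction `xᵢ`. -/
def IsCyclic (U : Set E3) (g : E3 → E3) : Prop :=
  ∃ i : Fin 3, ∀ j : Fin 3, j ≠ i → IsChannelFamily U g j i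

end GuichardNet

/-! Write a_ij = ∂ᵢHⱼ/Hⱼ (`logLame`) and u_k = εₖHₖ²/(H₁H₂H₃) (`factorDiff`). Then κ_ij = -a_ij/Hᵢ,
and the Guichard condition and its derivatives become the linear relations Σ u_l = 0 and Σ a_ml u_l
= 0. An associated system has factors with hᵢ₊₁ - hᵢ = uᵢ₊₂ and ∂ᵢhⱼ = (hᵢ - hⱼ) a_ij.

A Combescure transform has curvatures ±κ_ji/hᵢ, so where immersed it is channel along the xᵢ-lines
iff hᵢ ∂ᵢκ_ji = κ_ji ∂ᵢhᵢ. Two facts translate this into geometry: κ_ji = 0 for both j ≠ i says that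
Hᵢ varies only with xᵢ, which is parallelism; and ∂ᵢhᵢ = 0 holds exactly at the umbilics of xᵢ =
const (`pd_self_eq_zero_iff`). Parallelism thus kills both sides of the channel equation. Umbilicity
kills ∂ᵢhᵢ, and also ∂ᵢκ_ji by a Lamé equation (`pd_principalCurvature_of_umbilic`).

Conversely, adding c·f to an associated system replaces hᵢ by hᵢ + c. If all these systems are
cyclic, one index i serves infinitely many c, and comparing two of them gives κ_ji ∂ᵢhᵢ = 0
(`exists_index_of_isCyclic`). Hence each point is parallel or umbilic for that i. That a single
alternative holds on all of U is `parallel_or_umbilic`: the weighted difference (a_ij - a_ik)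
HⱼHₖ/Hᵢ has vanishing gradient, so it is constant. This direction needs an associated system to
start from, which the Poincaré lemma on the simply connected U supplies
(`IsGuichardNet.exists_factor`). -/

namespace GuichardNet

/-! ### Global primitives of closed 1-forms on simply connected sets -/

/-- On a simply connected space, local functions whose differences are locally constant glue,
up to locally constant functions, to a global function. -/
theorem exists_glue_of_locally_const_sub {B ι G : Type*} [TopologicalSpace B]
    [SimplyConnectedSpace B] [LocallyPathConnectedSpace B] [AddCommGroup G]
    (b : ι → Set B) (hb : ∀ i, IsOpen (b i)) (hcov : ∀ x, ∃ i, x ∈ b i) (g : ι → B → G)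
    (hg : ∀ i j, ∀ x ∈ b i ∩ b j, ∀ᶠ y in nhds x, g i y - g j y = g i x - g j x) :
    ∃ Φ : B → G, ∀ i, ∀ x ∈ b i, ∀ᶠ y in nhds x, Φ y - g i y = Φ x - g i x := by
  classical
  let _ : TopologicalSpace G := ⊥
  have : DiscreteTopology G := ⟨rfl⟩
  choose idx hidx using hcov
  -- The differences g i - g j are locally constant cocycles, hence continuous transition maps for a
  -- bundle with discrete fibre G: a covering of B.
  let Z : FiberBundleCore ι B G :=
    { baseSet := b
      isOpen_baseSet := hb
      indexAt := idx
      mem_baseSet_at := hidx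
      coordChange := fun i j x v => v + (g i x - g j x)
      coordChange_self := fun i x _ v => by simp
      continuousOn_coordChange := by
        intro i j
        rintro ⟨x, v⟩ ⟨hx, -⟩
        apply ContinuousAt.continuousWithinAt
        have h1 : ∀ᶠ p : B × G in nhds (x, v),
            p.2 + (g i p.1 - g j p.1) = p.2 + (g i x - g j x) := by
          have := (continuous_fst.tendsto (x, v)).eventually (hg i j x hx)
          filter_upwards [this] with p hp
          rw [hp]
        refine ContinuousAt.congr_of_eventuallyEq ?_ h1
        exact (continuous_of_discreteTopology
          (f := fun w : G => w + (g i x - g j x))).continuousAt.comp continuousAt_snd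
      coordChange_comp := fun i j k x _ v => by abel }
  have cov : IsCoveringMap (Bundle.TotalSpace.proj : Z.TotalSpace → B) :=
    FiberBundle.isCoveringMap
  let x₀ : B := Classical.arbitrary B
  -- Lifting the identity of the simply connected base gives a global section.
  obtain ⟨s, ⟨-, hs⟩, -⟩ := cov.existsUnique_continuousMap_lifts (ContinuousMap.id B) x₀
    (⟨x₀, (0 : G)⟩ : Z.TotalSpace) rfl
  have hs' : ∀ x, (s x).1 = x := fun x => congrFun hs x
  let v : B → G := fun x => (s x).2
  -- In chart i the section has coordinate Φ - g i; being continuous into a discrete space, it is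
  -- locally constant.
  refine ⟨fun x => v x + g (idx x) x, fun i x hx => ?_⟩
  have hc : ContinuousAt (fun y => (Z.localTriv i (s y)).2) x := by
    refine continuousAt_snd.comp (ContinuousAt.comp (f := s) ?_ s.continuous.continuousAt)
    refine (Z.localTriv i).continuousOn_toFun.continuousAt
      ((Z.localTriv i).open_source.mem_nhds ?_)
    rw [Z.mem_localTriv_source, hs']
    exact hx
  have hy : ∀ y, (Z.localTriv i (s y)).2 = v y + g (idx y) y - g i y := by
    intro y
    have : (Z.localTriv i (s y)).2 = v y + (g (idx (s y).1) (s y).1 - g i (s y).1) := rfl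
    rw [this, hs' y]
    abel
  have := hc.tendsto.eventually (show ∀ᶠ z in nhds _, z = (Z.localTriv i (s x)).2 by
    rw [nhds_discrete]; rfl)
  filter_upwards [this] with y h
  rwa [hy, hy] at h

/-- A closed `1`-form on a simply connected open set is exact. -/
theorem exists_hasFDerivAt_of_closed {E F : Type*} [NormedAddCommGroup E] [NormedSpace ℝ E]
    [NormedAddCommGroup F] [NormedSpace ℝ F] [CompleteSpace F] {U : Set E} (hU : IsOpen U)
    (hUs : IsSimplyConnected U) (η : E → E →L[ℝ] F) (hη : DifferentiableOn ℝ η U)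
    (hsymm : ∀ a ∈ U, ∀ x y, fderiv ℝ η a x y = fderiv ℝ η a y x) :
    ∃ g : E → F, ∀ a ∈ U, HasFDerivAt g (η a) a := by
  classical
  have := hUs.simplyConnectedSpace
  have := hU.locallyPathConnectedSpace
  have loc : ∀ p : U, ∃ r > 0, Metric.ball (p : E) r ⊆ U ∧
      ∃ g : E → F, ∀ a ∈ Metric.ball (p : E) r, HasFDerivAt g (η a) a := by
    intro p
    obtain ⟨r, hr, hrU⟩ := Metric.isOpen_iff.1 hU p p.2
    exact ⟨r, hr, hrU, (convex_ball _ _).exists_forall_hasFDerivAt_of_fderiv_symmetric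
      Metric.isOpen_ball (hη.mono hrU) fun a ha => hsymm a (hrU ha)⟩
  choose r hr hrU g hg using loc
  -- Primitives on two balls differ by a constant on the intersection, which is convex and so
  -- connected.
  obtain ⟨Φ, hΦ⟩ := exists_glue_of_locally_const_sub (B := U) (ι := U)
    (fun p => Subtype.val ⁻¹' Metric.ball (p : E) (r p))
    (fun p => Metric.isOpen_ball.preimage continuous_subtype_val)
    (fun p => ⟨p, Metric.mem_ball_self (hr p)⟩) (fun p x => g p x) (by
      rintro p q x ⟨hxp, hxq⟩
      have hopen : IsOpen (Metric.ball (p : E) (r p) ∩ Metric.ball (q : E) (r q)) :=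
        Metric.isOpen_ball.inter Metric.isOpen_ball
      have hconv : Convex ℝ (Metric.ball (p : E) (r p) ∩ Metric.ball (q : E) (r q)) :=
        (convex_ball _ _).inter (convex_ball _ _)
      have hd : ∀ a ∈ Metric.ball (p : E) (r p) ∩ Metric.ball (q : E) (r q),
          HasFDerivAt (fun y => g p y - g q y) (0 : E →L[ℝ] F) a := fun a ha => by
        have h := (hg p a ha.1).sub (hg q a ha.2)
        rw [sub_self] at h
        exact h
      have hnear := continuous_subtype_val.continuousAt.eventually
        (hopen.mem_nhds (show (x : E) ∈ _ from ⟨hxp, hxq⟩))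
      filter_upwards [hnear] with y hy
      exact hopen.is_const_of_fderiv_eq_zero hconv.isPreconnected
        (fun a ha => (hd a ha).differentiableAt.differentiableWithinAt)
        (fun a ha => (hd a ha).fderiv) hy ⟨hxp, hxq⟩)
  refine ⟨fun x => if hx : x ∈ U then Φ ⟨x, hx⟩ else 0, fun a ha => ?_⟩
  have h1 := hΦ ⟨a, ha⟩ ⟨a, ha⟩ (Metric.mem_ball_self (hr _))
  rw [nhds_subtype_eq_comap, Filter.eventually_comap] at h1
  have h2 := (hg ⟨a, ha⟩ a (Metric.mem_ball_self (hr _))).add_const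
    (Φ ⟨a, ha⟩ - g ⟨a, ha⟩ a)
  refine h2.congr_of_eventuallyEq ?_
  filter_upwards [h1, hU.mem_nhds ha] with y hy hyU
  have := hy ⟨y, hyU⟩ rfl
  simp only [hyU, dif_pos]
  rw [← this]
  abel

/-! ### Partial derivatives and the Poincaré lemma in coordinates -/

section Calculus

variable {F : Type*} [NormedAddCommGroup F] [NormedSpace ℝ F] {U : Set E3} {p : E3}

theorem diffAt_of_smooth {g : E3 → F} (hU : IsOpen U) (hg : ContDiffOn ℝ ∞ g U) (hp : p ∈ U) :
    DifferentiableAt ℝ g p :=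
  (hg.contDiffAt (hU.mem_nhds hp)).differentiableAt (by simp)

theorem smooth_pd {g : E3 → F} (hU : IsOpen U) (hg : ContDiffOn ℝ ∞ g U) (i : Fin 3) :
    ContDiffOn ℝ ∞ (pd i g) U :=
  ((contDiffOn_infty_iff_fderiv_of_isOpen hU).1 hg).2.clm_apply contDiffOn_const

theorem pd_congr {g g' : E3 → F} (h : g =ᶠ[nhds p] g') (i : Fin 3) : pd i g p = pd i g' p := by
  simp only [pd, h.fderiv_eq]

theorem pd_congr_on {g g' : E3 → F} (hU : IsOpen U) (h : ∀ q ∈ U, g q = g' q) (hp : p ∈ U)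
    (i : Fin 3) : pd i g p = pd i g' p :=
  pd_congr (Filter.eventuallyEq_of_mem (hU.mem_nhds hp) h) i

theorem pd_const (c : F) (i : Fin 3) : pd i (fun _ => c) p = 0 := by
  simp [pd]

theorem pd_add {g g' : E3 → F} (hg : DifferentiableAt ℝ g p) (hg' : DifferentiableAt ℝ g' p)
    (i : Fin 3) : pd i (fun q => g q + g' q) p = pd i g p + pd i g' p := by
  simp only [pd, fderiv_fun_add hg hg']; rfl

theorem pd_sub {g g' : E3 → F} (hg : DifferentiableAt ℝ g p) (hg' : DifferentiableAt ℝ g' p)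
    (i : Fin 3) : pd i (fun q => g q - g' q) p = pd i g p - pd i g' p := by
  simp only [pd, fderiv_fun_sub hg hg']; rfl

theorem pd_neg {g : E3 → F} (i : Fin 3) : pd i (fun q => -g q) p = -pd i g p := by
  simp only [pd, fderiv_fun_neg]; rfl

theorem pd_smul {a : E3 → ℝ} {g : E3 → F} (ha : DifferentiableAt ℝ a p)
    (hg : DifferentiableAt ℝ g p) (i : Fin 3) :
    pd i (fun q => a q • g q) p = pd i a p • g p + a p • pd i g p := by
  simp only [pd, fderiv_fun_smul ha hg]
  simp [add_comm]

theorem pd_mul {a b : E3 → ℝ} (ha : DifferentiableAt ℝ a p) (hb : DifferentiableAt ℝ b p)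
    (i : Fin 3) : pd i (fun q => a q * b q) p = pd i a p * b p + a p * pd i b p :=
  pd_smul ha hb i

theorem pd_div {a b : E3 → ℝ} (ha : DifferentiableAt ℝ a p) (hb : DifferentiableAt ℝ b p)
    (h0 : b p ≠ 0) (i : Fin 3) :
    pd i (fun q => a q / b q) p = (pd i a p * b p - a p * pd i b p) / b p ^ 2 := by
  have hinv : DifferentiableAt ℝ (fun q => (b q)⁻¹) p := hb.fun_inv h0
  have h1 : pd i (fun q => b q * (b q)⁻¹) p = 0 := by
    rw [← pd_const (p := p) (1 : ℝ) i]
    exact pd_congr ((hb.continuousAt.eventually_ne h0).mono fun q hq => mul_inv_cancel₀ hq) i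
  rw [pd_mul hb hinv] at h1
  simp only [div_eq_mul_inv]
  rw [pd_mul ha hinv]
  have h2 : pd i (fun q => (b q)⁻¹) p = -(pd i b p * (b p)⁻¹) / b p := by
    field_simp at h1 ⊢
    linear_combination h1
  rw [h2]
  field_simp
  ring

theorem diffAt_div {a b : E3 → ℝ} (ha : DifferentiableAt ℝ a p) (hb : DifferentiableAt ℝ b p)
    (h0 : b p ≠ 0) : DifferentiableAt ℝ (fun q => a q / b q) p := by
  simp only [div_eq_mul_inv]
  exact ha.fun_mul (hb.fun_inv h0)

theorem pd_inner {g g' : E3 → E3} (hg : DifferentiableAt ℝ g p) (hg' : DifferentiableAt ℝ g' p)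
    (i : Fin 3) :
    pd i (fun q => ⟪g q, g' q⟫_ℝ) p = ⟪pd i g p, g' p⟫_ℝ + ⟪g p, pd i g' p⟫_ℝ := by
  simp only [pd, fderiv_inner_apply ℝ hg hg']
  ring

theorem pd_comm {g : E3 → F} (hU : IsOpen U) (hg : ContDiffOn ℝ ∞ g U) (hp : p ∈ U)
    (i j : Fin 3) : pd i (pd j g) p = pd j (pd i g) p := by
  have hd : DifferentiableAt ℝ (fderiv ℝ g) p :=
    diffAt_of_smooth hU ((contDiffOn_infty_iff_fderiv_of_isOpen hU).1 hg).2 hp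
  have key : ∀ i j : Fin 3, pd i (pd j g) p =
      fderiv ℝ (fderiv ℝ g) p (EuclideanSpace.single i 1) (EuclideanSpace.single j 1) := by
    intro i j
    change fderiv ℝ (fun q => fderiv ℝ g q (EuclideanSpace.single j (1 : ℝ))) p _ = _
    rw [fderiv_clm_apply hd (differentiableAt_const _)]
    simp
  rw [key, key]
  refine ((hg.contDiffAt (hU.mem_nhds hp)).isSymmSndFDerivAt ?_) _ _
  simp only [minSmoothness_of_isRCLikeNormedField]
  exact WithTop.coe_le_coe.2 le_top

theorem euclidean_eq_sum (v : E3) :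
    v = ∑ i, v i • EuclideanSpace.single i (1 : ℝ) := by
  ext j
  simp [Fin.sum_univ_three]
  fin_cases j <;> simp

theorem clm_ext_single {L L' : E3 →L[ℝ] F}
    (h : ∀ i, L (EuclideanSpace.single i 1) = L' (EuclideanSpace.single i 1)) : L = L' := by
  ext v
  rw [euclidean_eq_sum v]
  simp only [map_sum, map_smul, h]

/-- The `1`-form with components `w`. -/
noncomputable def oneForm (w : Fin 3 → E3 → F) (q : E3) : E3 →L[ℝ] F :=
  ∑ i, (EuclideanSpace.proj i : E3 →L[ℝ] ℝ).smulRight (w i q)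

theorem oneForm_single (w : Fin 3 → E3 → F) (q : E3) (i : Fin 3) :
    oneForm w q (EuclideanSpace.single i 1) = w i q := by
  simp [oneForm, Fin.sum_univ_three]
  fin_cases i <;> simp

theorem smooth_oneForm {w : Fin 3 → E3 → F} (hw : ∀ i, ContDiffOn ℝ ∞ (w i) U) :
    ContDiffOn ℝ ∞ (oneForm w) U := by
  refine ContDiffOn.sum fun i _ => ?_
  exact contDiffOn_const.smulRight (hw i)

theorem smooth_of_pd {g : E3 → F} (hU : IsOpen U) (hd : ∀ q ∈ U, DifferentiableAt ℝ g q)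
    (h : ∀ i, ContDiffOn ℝ ∞ (pd i g) U) : ContDiffOn ℝ ∞ g U := by
  refine (contDiffOn_infty_iff_fderiv_of_isOpen hU).2
    ⟨fun q hq => (hd q hq).differentiableWithinAt, ?_⟩
  refine (smooth_oneForm h).congr fun q _ => clm_ext_single fun i => ?_
  rw [oneForm_single]; rfl

/-- The Poincaré lemma on a simply connected domain, in coordinates. -/
theorem exists_potential [CompleteSpace F] (hU : IsOpen U) (hUs : IsSimplyConnected U)
    (w : Fin 3 → E3 → F) (hw : ∀ i, ContDiffOn ℝ ∞ (w i) U)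
    (hc : ∀ q ∈ U, ∀ i j, pd i (w j) q = pd j (w i) q) :
    ∃ g : E3 → F, ContDiffOn ℝ ∞ g U ∧ ∀ q ∈ U, ∀ i, pd i g q = w i q := by
  have hs := smooth_oneForm hw
  have hfd : ∀ q ∈ U, ∀ i j : Fin 3, fderiv ℝ (oneForm w) q (EuclideanSpace.single i 1)
      (EuclideanSpace.single j 1) = pd i (w j) q := by
    intro q hq i j
    have h1 := fderiv_clm_apply (diffAt_of_smooth hU hs hq)
      (differentiableAt_const (EuclideanSpace.single j (1 : ℝ)))
    have h2 : w j = fun q => oneForm w q (EuclideanSpace.single j 1) :=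
      funext fun q => (oneForm_single w q j).symm
    rw [pd, h2, h1]
    simp
  obtain ⟨g, hg⟩ := exists_hasFDerivAt_of_closed hU hUs (oneForm w)
    (fun q hq => (diffAt_of_smooth hU hs hq).differentiableWithinAt) (by
      intro q hq x y
      have : fderiv ℝ (oneForm w) q = (fderiv ℝ (oneForm w) q).flip :=
        clm_ext_single fun i => clm_ext_single fun j => by
          rw [ContinuousLinearMap.flip_apply, hfd q hq, hfd q hq, hc q hq]
      conv_lhs => rw [this]
      rfl)
  have hpd : ∀ q ∈ U, ∀ i, pd i g q = w i q := fun q hq i => by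
    rw [pd, (hg q hq).fderiv, oneForm_single]
  exact ⟨g, smooth_of_pd hU (fun q hq => (hg q hq).differentiableAt)
    fun i => (hw i).congr fun q hq => hpd q hq i, hpd⟩

/-- A function whose partial derivatives vanish on a connected open set is constant there. -/
theorem eq_of_pd_eq_zero {g : E3 → F} (hU : IsOpen U) (hc : IsPreconnected U)
    (hd : ∀ q ∈ U, DifferentiableAt ℝ g q) (h : ∀ q ∈ U, ∀ i, pd i g q = 0) {q q' : E3}
    (hq : q ∈ U) (hq' : q' ∈ U) : g q = g q' :=
  hU.is_const_of_fderiv_eq_zero hc (fun x hx => (hd x hx).differentiableWithinAt)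
    (fun x hx => clm_ext_single fun i => h x hx i) hq hq'

end Calculus
-- Cross product in coordinates
section Cross

theorem inner_eq_sum (a b : E3) : ⟪a, b⟫_ℝ = a 0 * b 0 + a 1 * b 1 + a 2 * b 2 := by
  simp [PiLp.inner_apply, Fin.sum_univ_three]
  ring

theorem cross_apply_zero (a b : E3) : cross a b 0 = a 1 * b 2 - a 2 * b 1 := by
  simp [cross, crossProduct]

theorem cross_apply_one (a b : E3) : cross a b 1 = a 2 * b 0 - a 0 * b 2 := by
  simp [cross, crossProduct]

theorem cross_apply_two (a b : E3) : cross a b 2 = a 0 * b 1 - a 1 * b 0 := by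
  simp [cross, crossProduct]

theorem inner_cross_left (a b : E3) : ⟪a, cross a b⟫_ℝ = 0 := by
  rw [inner_eq_sum, cross_apply_zero, cross_apply_one, cross_apply_two]; ring

theorem inner_cross_right (a b : E3) : ⟪b, cross a b⟫_ℝ = 0 := by
  rw [inner_eq_sum, cross_apply_zero, cross_apply_one, cross_apply_two]; ring

theorem cross_smul_smul (s t : ℝ) (a b : E3) : cross (s • a) (t • b) = (s * t) • cross a b := by
  ext i
  fin_cases i
  · simp [cross_apply_zero]; ring
  · simp [cross_apply_one]; ring
  · simp [cross_apply_two]; ring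

theorem smooth_cross {U : Set E3} {a b : E3 → E3} (ha : ContDiffOn ℝ ∞ a U)
    (hb : ContDiffOn ℝ ∞ b U) : ContDiffOn ℝ ∞ (fun q => cross (a q) (b q)) U := by
  have ha' := contDiffOn_euclidean.1 ha
  have hb' := contDiffOn_euclidean.1 hb
  refine contDiffOn_euclidean.2 fun i => ?_
  fin_cases i
  · simp only [Fin.zero_eta, cross_apply_zero]
    exact ((ha' 1).mul (hb' 2)).sub ((ha' 2).mul (hb' 1))
  · simp only [Fin.mk_one, cross_apply_one]
    exact ((ha' 2).mul (hb' 0)).sub ((ha' 0).mul (hb' 2))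
  · simp only [Fin.reduceFinMk, cross_apply_two]
    exact ((ha' 0).mul (hb' 1)).sub ((ha' 1).mul (hb' 0))

end Cross

theorem add_one_ne (i : Fin 3) : i + 1 ≠ i := by decide +revert
theorem add_two_ne (i : Fin 3) : i + 2 ≠ i := by decide +revert
theorem add_two_ne_add_one (i : Fin 3) : i + 2 ≠ i + 1 := by decide +revert

theorem eq_zero_or_one_or_two (i : Fin 3) : i = 0 ∨ i = 1 ∨ i = 2 := by decide +revert

theorem eq_or_eq_or_eq {i j k : Fin 3} (hij : i ≠ j) (hik : i ≠ k) (hjk : j ≠ k) (m : Fin 3) :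
    m = i ∨ m = j ∨ m = k := by
  decide +revert

theorem eq_add_one_or_two {i j : Fin 3} (h : j ≠ i) : j = i + 1 ∨ j = i + 2 := by
  decide +revert

theorem exists_third {i j : Fin 3} (hij : i ≠ j) : ∃ k, i ≠ k ∧ j ≠ k := by
  decide +revert

theorem sum_distinct {i j k : Fin 3} (hij : i ≠ j) (hik : i ≠ k) (hjk : j ≠ k) (g : Fin 3 → ℝ) :
    ∑ l, g l = g i + g j + g k := by
  rw [Fin.sum_univ_three]
  fin_cases i <;> fin_cases j <;> fin_cases k <;> simp at * <;> ring

/-! ### Orthogonal frame and Lamé equations -/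

section Frame

variable {U : Set E3} {f : E3 → E3}

/-- The triple product of the partial derivatives is the Jacobian determinant. -/
theorem IsTriplyOrthogonal.inner_normalVector_ne (hf : IsTriplyOrthogonal U f) {p : E3}
    (hp : p ∈ U) (i : Fin 3) : ⟪pd i f p, normalVector f i p⟫_ℝ ≠ 0 := by
  have h := hf.det_ne_zero p hp
  intro h0
  apply h
  rw [Matrix.det_fin_three]
  simp only [Matrix.of_apply]
  rw [inner_eq_sum, normalVector, cross_apply_zero, cross_apply_one, cross_apply_two] at h0
  obtain rfl | rfl | rfl := eq_zero_or_one_or_two i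
  all_goals
    simp only [show (0 : Fin 3) + 1 = 1 from rfl, show (0 : Fin 3) + 2 = 2 from rfl,
      show (1 : Fin 3) + 1 = 2 from rfl, show (1 : Fin 3) + 2 = 0 from rfl,
      show (2 : Fin 3) + 1 = 0 from rfl, show (2 : Fin 3) + 2 = 1 from rfl] at h0
    linear_combination h0

theorem IsTriplyOrthogonal.pd_ne_zero (hf : IsTriplyOrthogonal U f) {p : E3} (hp : p ∈ U)
    (i : Fin 3) : pd i f p ≠ 0 := by
  intro h
  apply hf.inner_normalVector_ne hp i
  rw [h, inner_zero_left]

/-- The ∂ᵢf form a basis, so vector identities can be checked by pairing with them. -/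
theorem IsTriplyOrthogonal.ext_inner (hf : IsTriplyOrthogonal U f) {p : E3} (hp : p ∈ U)
    {v w : E3} (h : ∀ i, ⟪v, pd i f p⟫_ℝ = ⟪w, pd i f p⟫_ℝ) : v = w := by
  have hd := Matrix.eq_zero_of_vecMul_eq_zero (hf.det_ne_zero p hp) (v := WithLp.ofLp (v - w)) (by
    ext i
    have hi := h i
    rw [← sub_eq_zero, ← inner_sub_left, inner_eq_sum] at hi
    simpa [Matrix.vecMul, dotProduct, Fin.sum_univ_three] using hi)
  rw [← sub_eq_zero]
  ext i
  exact congrFun hd i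

theorem IsTriplyOrthogonal.normalVector_eq (hf : IsTriplyOrthogonal U f) {p : E3} (hp : p ∈ U)
    (i : Fin 3) : ∃ c : ℝ, c ≠ 0 ∧ normalVector f i p = c • pd i f p := by
  have h0 := hf.pd_ne_zero hp i
  have h1 : ⟪pd i f p, pd i f p⟫_ℝ ≠ 0 := inner_self_ne_zero.2 h0
  refine ⟨⟪pd i f p, normalVector f i p⟫_ℝ / ⟪pd i f p, pd i f p⟫_ℝ,
    div_ne_zero (hf.inner_normalVector_ne hp i) h1, hf.ext_inner hp fun j => ?_⟩
  rw [inner_smul_left]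
  by_cases hj : j = i
  · subst hj
    rw [real_inner_comm]
    simp only [conj_trivial]
    field_simp
  · rw [hf.orthogonal p hp i j (Ne.symm hj), mul_zero, real_inner_comm]
    rcases eq_add_one_or_two hj with rfl | rfl
    · exact inner_cross_left _ _
    · exact inner_cross_right _ _

theorem IsTriplyOrthogonal.normalVector_ne_zero (hf : IsTriplyOrthogonal U f) {p : E3}
    (hp : p ∈ U) (i : Fin 3) : normalVector f i p ≠ 0 := by
  obtain ⟨c, hc, h⟩ := hf.normalVector_eq hp i
  rw [h]
  exact smul_ne_zero hc (hf.pd_ne_zero hp i)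

theorem IsTriplyOrthogonal.norm_unitNormal (hf : IsTriplyOrthogonal U f) {p : E3}
    (hp : p ∈ U) (i : Fin 3) : ‖unitNormal f i p‖ = 1 :=
  norm_smul_inv_norm (𝕜 := ℝ) (hf.normalVector_ne_zero hp i)

theorem IsTriplyOrthogonal.pd_eq (hf : IsTriplyOrthogonal U f) {p : E3} (hp : p ∈ U)
    (i : Fin 3) : pd i f p = lame f i p • unitNormal f i p := by
  obtain ⟨c, hc, h⟩ := hf.normalVector_eq hp i
  have hX : pd i f p = (c⁻¹ * ‖normalVector f i p‖) • unitNormal f i p := by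
    have hn : ‖normalVector f i p‖ ≠ 0 := norm_ne_zero_iff.2 (hf.normalVector_ne_zero hp i)
    rw [unitNormal, smul_smul, mul_assoc, mul_inv_cancel₀ hn, mul_one, h, smul_smul,
      inv_mul_cancel₀ hc, one_smul]
  have hl : lame f i p = c⁻¹ * ‖normalVector f i p‖ := by
    rw [lame, hX, inner_smul_left, real_inner_self_eq_norm_sq, hf.norm_unitNormal hp]
    simp
  rw [hl, ← hX]

theorem IsTriplyOrthogonal.lame_ne_zero (hf : IsTriplyOrthogonal U f) {p : E3} (hp : p ∈ U)
    (i : Fin 3) : lame f i p ≠ 0 := by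
  intro h
  apply hf.pd_ne_zero hp i
  rw [hf.pd_eq hp, h, zero_smul]

theorem IsTriplyOrthogonal.inner_pd_pd_self (hf : IsTriplyOrthogonal U f) {p : E3} (hp : p ∈ U)
    (i : Fin 3) : ⟪pd i f p, pd i f p⟫_ℝ = lame f i p ^ 2 := by
  rw [hf.pd_eq hp, inner_smul_left, inner_smul_right, real_inner_self_eq_norm_sq,
    hf.norm_unitNormal hp]
  simp [sq]

theorem IsTriplyOrthogonal.unitNormal_eq (hf : IsTriplyOrthogonal U f) {p : E3} (hp : p ∈ U)
    (i : Fin 3) : unitNormal f i p = (lame f i p)⁻¹ • pd i f p := by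
  rw [hf.pd_eq hp, smul_smul, inv_mul_cancel₀ (hf.lame_ne_zero hp i), one_smul]

theorem IsTriplyOrthogonal.smooth_unitNormal (hU : IsOpen U) (hf : IsTriplyOrthogonal U f)
    (i : Fin 3) : ContDiffOn ℝ ∞ (unitNormal f i) U := by
  have hn : ContDiffOn ℝ ∞ (normalVector f i) U :=
    smooth_cross (smooth_pd hU hf.smooth _) (smooth_pd hU hf.smooth _)
  exact ((hn.norm ℝ fun p hp => hf.normalVector_ne_zero hp i).inv
    fun p hp => norm_ne_zero_iff.2 (hf.normalVector_ne_zero hp i)).smul hn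

theorem IsTriplyOrthogonal.smooth_lame (hU : IsOpen U) (hf : IsTriplyOrthogonal U f)
    (i : Fin 3) : ContDiffOn ℝ ∞ (lame f i) U :=
  (smooth_pd hU hf.smooth i).inner ℝ (hf.smooth_unitNormal hU i)

/-- The logarithmic derivative `∂ᵢHⱼ / Hⱼ` of a Lamé coefficient. -/
noncomputable def logLame (f : E3 → E3) (i j : Fin 3) (p : E3) : ℝ :=
  pd i (lame f j) p / lame f j p

theorem IsTriplyOrthogonal.smooth_logLame (hU : IsOpen U) (hf : IsTriplyOrthogonal U f)
    (i j : Fin 3) : ContDiffOn ℝ ∞ (logLame f i j) U :=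
  (smooth_pd hU (hf.smooth_lame hU j) i).div (hf.smooth_lame hU j)
    fun _ hp => hf.lame_ne_zero hp j

variable {p : E3}

theorem IsTriplyOrthogonal.pd_lame (hf : IsTriplyOrthogonal U f)
    (hp : p ∈ U) (i j : Fin 3) : pd i (lame f j) p = logLame f i j p * lame f j p := by
  rw [logLame, div_mul_cancel₀ _ (hf.lame_ne_zero hp j)]

theorem IsTriplyOrthogonal.inner_pd_pd (hU : IsOpen U) (hf : IsTriplyOrthogonal U f)
    (hp : p ∈ U) (i j : Fin 3) :
    ⟪pd i (pd j f) p, pd j f p⟫_ℝ = logLame f i j p * lame f j p ^ 2 := by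
  have hX := diffAt_of_smooth hU (smooth_pd hU hf.smooth j) hp
  have hH := diffAt_of_smooth hU (hf.smooth_lame hU j) hp
  have h1 := pd_inner hX hX i
  have h2 : pd i (fun q => ⟪pd j f q, pd j f q⟫_ℝ) p = pd i (fun q => lame f j q * lame f j q) p :=
    pd_congr_on hU (fun q hq => by rw [hf.inner_pd_pd_self hq, sq]) hp i
  rw [h1, pd_mul hH hH, hf.pd_lame hp, real_inner_comm] at h2
  rw [real_inner_comm]
  linear_combination h2 / 2

theorem IsTriplyOrthogonal.inner_pd_pd_add (hU : IsOpen U) (hf : IsTriplyOrthogonal U f)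
    (hp : p ∈ U) (m : Fin 3) {i j : Fin 3} (hij : i ≠ j) :
    ⟪pd m (pd i f) p, pd j f p⟫_ℝ + ⟪pd m (pd j f) p, pd i f p⟫_ℝ = 0 := by
  have h1 := pd_inner (diffAt_of_smooth hU (smooth_pd hU hf.smooth i) hp)
    (diffAt_of_smooth hU (smooth_pd hU hf.smooth j) hp) m
  have h2 : pd m (fun q => ⟪pd i f q, pd j f q⟫_ℝ) p = pd m (fun _ => (0 : ℝ)) p :=
    pd_congr_on hU (fun q hq => hf.orthogonal q hq i j hij) hp m
  rw [h1, pd_const, real_inner_comm (pd m (pd j f) p)] at h2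
  exact h2

theorem IsTriplyOrthogonal.inner_pd_pd_of_ne (hU : IsOpen U) (hf : IsTriplyOrthogonal U f)
    (hp : p ∈ U) {i j : Fin 3} (hij : i ≠ j) :
    ⟪pd j (pd j f) p, pd i f p⟫_ℝ = -(logLame f i j p * lame f j p ^ 2) := by
  have h1 := hf.inner_pd_pd_add hU hp j hij
  rw [pd_comm hU hf.smooth hp, hf.inner_pd_pd hU hp] at h1
  linear_combination h1

/-- The analytic core of Dupin's theorem: ∂ᵢ∂ⱼf has no component along the third direction. The
other two components come from differentiating |∂ⱼf|² and |∂ᵢf|². -/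
theorem IsTriplyOrthogonal.pd_pd (hU : IsOpen U) (hf : IsTriplyOrthogonal U f)
    (hp : p ∈ U) {i j : Fin 3} (hij : i ≠ j) :
    pd i (pd j f) p = logLame f i j p • pd j f p + logLame f j i p • pd i f p := by
  obtain ⟨k, hik, hjk⟩ := exists_third hij
  refine hf.ext_inner hp fun m => ?_
  rw [inner_add_left, inner_smul_left, inner_smul_left]
  simp only [conj_trivial]
  rcases eq_or_eq_or_eq hij hik hjk m with rfl | rfl | rfl
  · rw [hf.orthogonal p hp _ _ hij.symm, pd_comm hU hf.smooth hp, hf.inner_pd_pd hU hp,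
      hf.inner_pd_pd_self hp]
    ring
  · rw [hf.orthogonal p hp _ _ hij, hf.inner_pd_pd hU hp, hf.inner_pd_pd_self hp]
    ring
  · rw [hf.orthogonal p hp _ _ hik, hf.orthogonal p hp _ _ hjk]
    -- Differentiating the three orthogonality relations, each in the remaining variable, and
    -- combining them as in the Koszul formula isolates 2⟨∂ᵢ∂ⱼf, ∂ₖf⟩.
    have h1 := hf.inner_pd_pd_add hU hp i hjk
    have h2 := hf.inner_pd_pd_add hU hp j hik
    have h3 := hf.inner_pd_pd_add hU hp m hij
    rw [pd_comm hU hf.smooth hp j i] at h2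
    rw [pd_comm hU hf.smooth hp m i, pd_comm hU hf.smooth hp m j] at h3
    linear_combination (h1 + h2 - h3) / 2

/-- The Lamé equations of the first kind. -/
theorem IsTriplyOrthogonal.pd_logLame (hU : IsOpen U) (hf : IsTriplyOrthogonal U f)
    (hp : p ∈ U) {i j k : Fin 3} (hij : i ≠ j) (hik : i ≠ k) (hjk : j ≠ k) :
    pd i (logLame f k j) p = logLame f i k p * logLame f k j p
      + logLame f k i p * logLame f i j p - logLame f k j p * logLame f i j p := by
  -- Compare the ∂ⱼf-components of ∂ᵢ∂ⱼ∂ₖf and ∂ⱼ∂ᵢ∂ₖf; the second conjunct serves the swapped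
  -- order.
  have expand : ∀ {i j : Fin 3}, i ≠ j → i ≠ k → j ≠ k →
      ⟪pd i (pd j (pd k f)) p, pd j f p⟫_ℝ =
        (pd i (logLame f k j) p + logLame f k j p * logLame f i j p) * lame f j p ^ 2 ∧
      ⟪pd i (pd j (pd k f)) p, pd i f p⟫_ℝ =
        (logLame f j k p * logLame f k i p + logLame f k j p * logLame f j i p)
          * lame f i p ^ 2 := by
    intro i j hij hik hjk
    have dX := fun l => diffAt_of_smooth hU (smooth_pd hU hf.smooth l) hp
    have da := fun l m => diffAt_of_smooth hU (hf.smooth_logLame hU l m) hp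
    have h1 : pd i (pd j (pd k f)) p = pd i (fun q => logLame f j k q • pd k f q
        + logLame f k j q • pd j f q) p :=
      pd_congr_on hU (fun q hq => hf.pd_pd hU hq hjk) hp i
    rw [pd_add ((da _ _).fun_smul (dX _)) ((da _ _).fun_smul (dX _)), pd_smul (da _ _) (dX _),
      pd_smul (da _ _) (dX _), hf.pd_pd hU hp hik, hf.pd_pd hU hp hij] at h1
    rw [h1]
    simp only [inner_add_left, inner_smul_left, conj_trivial, hf.inner_pd_pd_self hp,
      hf.orthogonal p hp _ _ hjk.symm, hf.orthogonal p hp _ _ hik.symm, hf.orthogonal p hp _ _ hij,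
      hf.orthogonal p hp _ _ hij.symm]
    constructor <;> ring
  have h1 := (expand hij hik hjk).1
  have h2 := (expand hij.symm hjk hik).2
  rw [pd_comm hU (smooth_pd hU hf.smooth k) hp, h1] at h2
  have h3 := mul_right_cancel₀ (pow_ne_zero 2 (hf.lame_ne_zero hp j)) h2
  linear_combination h3

theorem IsTriplyOrthogonal.pd_logLame_comm (hU : IsOpen U) (hf : IsTriplyOrthogonal U f)
    (hp : p ∈ U) (i j k : Fin 3) : pd i (logLame f j k) p = pd j (logLame f i k) p := by
  have hH := diffAt_of_smooth hU (hf.smooth_lame hU k) hp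
  have dH := fun l => diffAt_of_smooth hU (smooth_pd hU (hf.smooth_lame hU k) l) hp
  have h0 := hf.lame_ne_zero hp k
  change pd i (fun q => pd j (lame f k) q / lame f k q) p =
    pd j (fun q => pd i (lame f k) q / lame f k q) p
  rw [pd_div (dH _) hH h0, pd_div (dH _) hH h0, pd_comm hU (hf.smooth_lame hU k) hp]
  ring

theorem IsTriplyOrthogonal.principalCurvature_eq (hU : IsOpen U) (hf : IsTriplyOrthogonal U f)
    (hp : p ∈ U) {i j : Fin 3} (hij : i ≠ j) :
    principalCurvature f i j p = -logLame f i j p / lame f i p := by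
  have hi := hf.lame_ne_zero hp i
  have hj := hf.lame_ne_zero hp j
  rw [principalCurvature, hf.unitNormal_eq hp, inner_smul_right, hf.inner_pd_pd_of_ne hU hp hij,
    ← real_inner_self_eq_norm_sq, hf.inner_pd_pd_self hp]
  field_simp

theorem IsTriplyOrthogonal.smooth_principalCurvature (hU : IsOpen U) (hf : IsTriplyOrthogonal U f)
    {i j : Fin 3} (hij : i ≠ j) : ContDiffOn ℝ ∞ (principalCurvature f i j) U :=
  ((hf.smooth_logLame hU i j).neg.div (hf.smooth_lame hU i)
    fun _ hp => hf.lame_ne_zero hp i).congr fun _ hp => hf.principalCurvature_eq hU hp hij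

theorem IsTriplyOrthogonal.isTotallyUmbilicFamily_iff (hU : IsOpen U)
    (hf : IsTriplyOrthogonal U f) {i j k : Fin 3} (hij : i ≠ j) (hik : i ≠ k) (hjk : j ≠ k) :
    IsTotallyUmbilicFamily U f i ↔ ∀ p ∈ U, logLame f i j p = logLame f i k p := by
  refine forall₂_congr fun p hp => ?_
  rw [hf.principalCurvature_eq hU hp (add_one_ne i).symm,
    hf.principalCurvature_eq hU hp (add_two_ne i).symm, div_left_inj' (hf.lame_ne_zero hp i),
    neg_inj]
  rcases eq_add_one_or_two hij.symm with rfl | rfl <;>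
    rcases eq_add_one_or_two hik.symm with rfl | rfl
  · exact absurd rfl hjk
  · rfl
  · exact eq_comm
  · exact absurd rfl hjk

end Frame
-- Factors of associated systems and their existence
section Associated

variable {U : Set E3} {f : E3 → E3} {p : E3}

/-- The difference `εₖ Hₖ / (Hᵢ Hⱼ)` of two factors of an associated system. -/
noncomputable def factorDiff (f : E3 → E3) (k : Fin 3) (p : E3) : ℝ :=
  sign k * lame f k p ^ 2 / ∏ l, lame f l p

theorem sign_ne_zero (k : Fin 3) : sign k ≠ 0 := by
  obtain rfl | rfl | rfl := eq_zero_or_one_or_two k <;> simp [sign]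

theorem IsTriplyOrthogonal.prod_lame_ne_zero (hf : IsTriplyOrthogonal U f) (hp : p ∈ U) :
    ∏ l, lame f l p ≠ 0 :=
  Finset.prod_ne_zero_iff.2 fun l _ => hf.lame_ne_zero hp l

theorem IsTriplyOrthogonal.factorDiff_ne_zero (hf : IsTriplyOrthogonal U f) (hp : p ∈ U)
    (k : Fin 3) : factorDiff f k p ≠ 0 :=
  div_ne_zero (mul_ne_zero (sign_ne_zero k) (pow_ne_zero 2 (hf.lame_ne_zero hp k)))
    (hf.prod_lame_ne_zero hp)

theorem IsTriplyOrthogonal.factorDiff_eq (hf : IsTriplyOrthogonal U f) (hp : p ∈ U)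
    (i : Fin 3) : sign (i + 2) * lame f (i + 2) p / (lame f i p * lame f (i + 1) p) =
      factorDiff f (i + 2) p := by
  have h0 := hf.lame_ne_zero hp 0
  have h1 := hf.lame_ne_zero hp 1
  have h2 := hf.lame_ne_zero hp 2
  rw [factorDiff, Fin.prod_univ_three]
  obtain rfl | rfl | rfl := eq_zero_or_one_or_two i
  all_goals
    simp only [show (0 : Fin 3) + 1 = 1 from rfl, show (0 : Fin 3) + 2 = 2 from rfl,
      show (1 : Fin 3) + 1 = 2 from rfl, show (1 : Fin 3) + 2 = 0 from rfl,
      show (2 : Fin 3) + 1 = 0 from rfl, show (2 : Fin 3) + 2 = 1 from rfl]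
    field_simp

theorem IsTriplyOrthogonal.smooth_factorDiff (hU : IsOpen U) (hf : IsTriplyOrthogonal U f)
    (k : Fin 3) : ContDiffOn ℝ ∞ (factorDiff f k) U :=
  (contDiffOn_const.mul ((hf.smooth_lame hU k).pow 2)).div
    (contDiffOn_prod fun l _ => hf.smooth_lame hU l) fun _ hp => hf.prod_lame_ne_zero hp

theorem IsGuichardNet.sum_factorDiff (hf : IsGuichardNet U f) (hp : p ∈ U) :
    ∑ l, factorDiff f l p = 0 := by
  have h := hf.guichard p hp
  simp only [factorDiff, ← Finset.sum_div, Fin.sum_univ_three, sign]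
  simp only [Matrix.cons_val]
  rw [show 1 * lame f 0 p ^ 2 + 1 * lame f 1 p ^ 2 + -1 * lame f 2 p ^ 2 = 0 by
    linear_combination h, zero_div]

/-- This is half the derivative of the Guichard condition, divided by H₁H₂H₃. -/
theorem IsGuichardNet.sum_logLame_mul_factorDiff (hU : IsOpen U) (hf : IsGuichardNet U f)
    (hp : p ∈ U) (m : Fin 3) : ∑ l, logLame f m l p * factorDiff f l p = 0 := by
  have hT := hf.toIsTriplyOrthogonal
  have dH := fun l => diffAt_of_smooth hU (hT.smooth_lame hU l) hp
  have h1 : pd m (fun q => lame f 0 q * lame f 0 q + lame f 1 q * lame f 1 q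
      - lame f 2 q * lame f 2 q) p = pd m (fun _ => (0 : ℝ)) p :=
    pd_congr_on hU (fun q hq => by rw [← hf.guichard q hq]; ring) hp m
  rw [pd_const, pd_sub (((dH 0).fun_mul (dH 0)).fun_add ((dH 1).fun_mul (dH 1)))
    ((dH 2).fun_mul (dH 2)), pd_add ((dH 0).fun_mul (dH 0)) ((dH 1).fun_mul (dH 1)),
    pd_mul (dH 0) (dH 0), pd_mul (dH 1) (dH 1), pd_mul (dH 2) (dH 2), hT.pd_lame hp,
    hT.pd_lame hp, hT.pd_lame hp] at h1
  simp only [factorDiff, ← mul_div_assoc, ← Finset.sum_div, Fin.sum_univ_three, sign]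
  simp only [Matrix.cons_val]
  rw [div_eq_zero_iff]
  left
  linear_combination h1 / 2

theorem IsTriplyOrthogonal.pd_factorDiff (hU : IsOpen U) (hf : IsTriplyOrthogonal U f)
    (hp : p ∈ U) (m : Fin 3) {i j k : Fin 3} (hij : i ≠ j) (hik : i ≠ k) (hjk : j ≠ k) :
    pd m (factorDiff f k) p =
      factorDiff f k p * (logLame f m k p - logLame f m i p - logLame f m j p) := by
  have dH := fun l => diffAt_of_smooth hU (hf.smooth_lame hU l) hp
  have hprod : ∀ q, ∏ l, lame f l q = lame f i q * lame f j q * lame f k q := by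
    intro q
    rw [Fin.prod_univ_three]
    obtain rfl | rfl | rfl := eq_zero_or_one_or_two i <;>
    obtain rfl | rfl | rfl := eq_zero_or_one_or_two j <;>
    obtain rfl | rfl | rfl := eq_zero_or_one_or_two k <;>
    first | exact absurd rfl hij | exact absurd rfl hik | exact absurd rfl hjk | ring
  have hi := hf.lame_ne_zero hp i
  have hj := hf.lame_ne_zero hp j
  have hk := hf.lame_ne_zero hp k
  have h1 : pd m (factorDiff f k) p =
      pd m (fun q => sign k * lame f k q / (lame f i q * lame f j q)) p := by
    refine pd_congr_on hU (fun q hq => ?_) hp m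
    have hk := hf.lame_ne_zero hq k
    have hi := hf.lame_ne_zero hq i
    have hj := hf.lame_ne_zero hq j
    rw [factorDiff, hprod]
    field_simp
  rw [h1, pd_div ((differentiableAt_const _).fun_mul (dH k)) ((dH i).fun_mul (dH j))
    (mul_ne_zero hi hj), pd_mul (differentiableAt_const _) (dH k), pd_const,
    pd_mul (dH i) (dH j), hf.pd_lame hp, hf.pd_lame hp, hf.pd_lame hp, factorDiff, hprod]
  field_simp
  ring

/-- The factors of an associated system, with the equations making
`h₁ ∂₁f dx₁ + h₂ ∂₂f dx₂ + h₃ ∂₃f dx₃` closed. -/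
structure IsAssociatedFactor (U : Set E3) (f : E3 → E3) (h : Fin 3 → E3 → ℝ) : Prop where
  smooth : ∀ i, ContDiffOn ℝ ∞ (h i) U
  sub_eq : ∀ p ∈ U, ∀ i, h (i + 1) p - h i p = factorDiff f (i + 2) p
  pd_eq : ∀ p ∈ U, ∀ i j, i ≠ j → pd i (h j) p = (h i p - h j p) * logLame f i j p

theorem IsTriplyOrthogonal.pd_pd_combescure (hU : IsOpen U) (hf : IsTriplyOrthogonal U f)
    {h : Fin 3 → E3 → ℝ} (hh : ∀ i, ContDiffOn ℝ ∞ (h i) U) (hp : p ∈ U) {i j : Fin 3}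
    (hij : i ≠ j) : pd i (fun q => h j q • pd j f q) p =
      (pd i (h j) p + h j p * logLame f i j p) • pd j f p
        + (h j p * logLame f j i p) • pd i f p := by
  rw [pd_smul (diffAt_of_smooth hU (hh j) hp)
    (diffAt_of_smooth hU (smooth_pd hU hf.smooth j) hp), hf.pd_pd hU hp hij, smul_add, smul_smul,
    smul_smul, add_smul, add_assoc]

/-- The definition asks no smoothness of the factors, but hᵢ = ⟨∂ᵢf̂, ∂ᵢf⟩/|∂ᵢf|² provides it. The
differential equations are the symmetry of the mixed derivatives of f̂, read off along ∂ⱼf. -/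
theorem IsAssociatedSystem.exists_factor (hU : IsOpen U) (hf : IsTriplyOrthogonal U f)
    {fhat : E3 → E3} (hfhat : IsAssociatedSystem U f fhat) :
    ∃ h, IsAssociatedFactor U f h ∧ ∀ p ∈ U, ∀ i, pd i fhat p = h i p • pd i f p := by
  obtain ⟨hs, h, hh⟩ := hfhat
  have hsm : ∀ i, ContDiffOn ℝ ∞ (h i) U := by
    intro i
    have hX := smooth_pd hU hf.smooth i
    refine (((smooth_pd hU hs i).inner ℝ hX).div (hX.inner ℝ hX)
      fun q hq => inner_self_ne_zero.2 (hf.pd_ne_zero hq i)).congr fun q hq => ?_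
    change h i q = ⟪pd i fhat q, pd i f q⟫_ℝ / ⟪pd i f q, pd i f q⟫_ℝ
    rw [(hh q hq i).1, inner_smul_left, conj_trivial,
      mul_div_cancel_right₀ _ (inner_self_ne_zero.2 (hf.pd_ne_zero hq i))]
  refine ⟨h, ⟨hsm, fun p hp i => ?_, fun p hp i j hij => ?_⟩, fun p hp i => (hh p hp i).1⟩
  · rw [(hh p hp i).2, hf.factorDiff_eq hp]
  · have h1 : pd i (pd j fhat) p = pd i (fun q => h j q • pd j f q) p :=
      pd_congr_on hU (fun q hq => (hh q hq j).1) hp i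
    have h2 : pd j (pd i fhat) p = pd j (fun q => h i q • pd i f q) p :=
      pd_congr_on hU (fun q hq => (hh q hq i).1) hp j
    rw [pd_comm hU hs hp, h2, hf.pd_pd_combescure hU hsm hp hij,
      hf.pd_pd_combescure hU hsm hp hij.symm] at h1
    have h3 := congrArg (fun v => ⟪v, pd j f p⟫_ℝ) h1
    simp only [inner_add_left, inner_smul_left, conj_trivial, hf.orthogonal p hp _ _ hij,
      hf.inner_pd_pd_self hp, mul_zero, zero_add, add_zero] at h3
    have h4 := mul_right_cancel₀ (pow_ne_zero 2 (hf.lame_ne_zero hp j)) h3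
    linear_combination -h4

theorem IsAssociatedFactor.exists_system (hU : IsOpen U) (hUs : IsSimplyConnected U)
    (hf : IsTriplyOrthogonal U f) {h : Fin 3 → E3 → ℝ} (hh : IsAssociatedFactor U f h) :
    ∃ fhat, ContDiffOn ℝ ∞ fhat U ∧ ∀ p ∈ U, ∀ i, pd i fhat p = h i p • pd i f p := by
  refine exists_potential hU hUs (fun i q => h i q • pd i f q)
    (fun i => (hh.smooth i).smul (smooth_pd hU hf.smooth i)) fun q hq i j => ?_
  by_cases hij : i = j
  · rw [hij]
  · rw [hf.pd_pd_combescure hU hh.smooth hq hij, hf.pd_pd_combescure hU hh.smooth hq (Ne.symm hij),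
      hh.pd_eq q hq i j hij, hh.pd_eq q hq j i (Ne.symm hij), add_comm]
    congr 2 <;> ring

theorem IsAssociatedFactor.isAssociatedSystem (hf : IsTriplyOrthogonal U f) {h : Fin 3 → E3 → ℝ}
    (hh : IsAssociatedFactor U f h) {fhat : E3 → E3} (hs : ContDiffOn ℝ ∞ fhat U)
    (hfhat : ∀ p ∈ U, ∀ i, pd i fhat p = h i p • pd i f p) : IsAssociatedSystem U f fhat :=
  ⟨hs, h, fun p hp i => ⟨hfhat p hp i, by rw [hh.sub_eq p hp, hf.factorDiff_eq hp]⟩⟩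

/-- The equations see only differences and derivatives of the factors; the shift corresponds to
adding c·f to the system. -/
theorem IsAssociatedFactor.add_const (hU : IsOpen U) {h : Fin 3 → E3 → ℝ}
    (hh : IsAssociatedFactor U f h) (c : ℝ) : IsAssociatedFactor U f fun i q => h i q + c := by
  refine ⟨fun i => (hh.smooth i).add contDiffOn_const, fun p hp i => ?_, fun p hp i j hij => ?_⟩
  · rw [← hh.sub_eq p hp]; ring
  · rw [pd_add (diffAt_of_smooth hU (hh.smooth j) hp) (differentiableAt_const _), pd_const,
      hh.pd_eq p hp i j hij]
    ring

/-- The associated systems of a Guichard net exist on simply connected domains. -/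
theorem IsGuichardNet.exists_factor (hU : IsOpen U) (hUs : IsSimplyConnected U)
    (hf : IsGuichardNet U f) : ∃ h, IsAssociatedFactor U f h := by
  have hT := hf.toIsTriplyOrthogonal
  have h01 : (0 : Fin 3) ≠ 1 := by decide
  have h02 : (0 : Fin 3) ≠ 2 := by decide
  have h12 : (1 : Fin 3) ≠ 2 := by decide
  have sa := hT.smooth_logLame hU
  have su := hT.smooth_factorDiff hU
  have hsum : ∀ q ∈ U, factorDiff f 0 q + factorDiff f 1 q + factorDiff f 2 q = 0 :=
    fun q hq => by rw [← hf.sum_factorDiff hq, Fin.sum_univ_three]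
  have hrow : ∀ q ∈ U, ∀ m, logLame f m 0 q * factorDiff f 0 q + logLame f m 1 q * factorDiff f 1 q
      + logLame f m 2 q * factorDiff f 2 q = 0 :=
    fun q hq m => by rw [← hf.sum_logLame_mul_factorDiff hU hq m, Fin.sum_univ_three]
  set u := factorDiff f
  set a := logLame f
  have d1 : ∀ q ∈ U, ∀ m, pd m (u 1) q = u 1 q * (a m 1 q - a m 0 q - a m 2 q) :=
    fun q hq m => hT.pd_factorDiff hU hq m h02 h01 h12.symm
  have d2 : ∀ q ∈ U, ∀ m, pd m (u 2) q = u 2 q * (a m 2 q - a m 0 q - a m 1 q) :=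
    fun q hq m => hT.pd_factorDiff hU hq m h01 h02 h12
  have da := fun l m {q} (hq : q ∈ U) => diffAt_of_smooth hU (sa l m) hq
  have du := fun l {q} (hq : q ∈ U) => diffAt_of_smooth hU (su l) hq
  have c01 : ∀ q ∈ U, pd 0 (fun q => u 2 q * a 1 0 q) q =
      pd 1 (fun q => -(u 2 q * (a 0 2 q - a 0 0 q))) q := by
    intro q hq
    have e1 := hT.pd_logLame_comm hU hq 1 0 0
    have e2 := hT.pd_logLame hU hq h12 h01.symm h02.symm
    rw [pd_neg, pd_mul (du 2 hq) (da 1 0 hq), pd_mul (du 2 hq) ((da 0 2 hq).fun_sub (da 0 0 hq)),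
      pd_sub (da 0 2 hq) (da 0 0 hq), d2 q hq, d2 q hq]
    linear_combination u 2 q * (-e1 + e2) + (a 1 0 q - a 1 1 q) * hrow q hq 0
      - (a 0 0 q - a 0 1 q) * hrow q hq 1 + (a 0 0 q * a 1 1 q - a 0 1 q * a 1 0 q) * hsum q hq
  have c02 : ∀ q ∈ U, pd 0 (fun q => -(u 1 q * a 2 0 q)) q =
      pd 2 (fun q => -(u 2 q * (a 0 2 q - a 0 0 q))) q := by
    intro q hq
    -- The Guichard relations trade a₀₂ for a₀₁, whose x₂-derivative, with three distinct indices,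
    -- is given by a Lamé equation.
    have e0 : pd 2 (fun q => -(u 2 q * (a 0 2 q - a 0 0 q))) q =
        pd 2 (fun q => u 1 q * (a 0 1 q - a 0 0 q)) q :=
      pd_congr_on hU (fun q hq => by linear_combination a 0 0 q * hsum q hq - hrow q hq 0) hq 2
    have e1 := hT.pd_logLame_comm hU hq 2 0 0
    have e2 := hT.pd_logLame hU hq h12.symm h02.symm h01.symm
    rw [e0, pd_neg, pd_mul (du 1 hq) (da 2 0 hq),
      pd_mul (du 1 hq) ((da 0 1 hq).fun_sub (da 0 0 hq)),
      pd_sub (da 0 1 hq) (da 0 0 hq), d1 q hq, d1 q hq]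
    linear_combination -u 1 q * (-e1 + e2) - (a 2 0 q - a 2 2 q) * hrow q hq 0
      + (a 0 0 q - a 0 2 q) * hrow q hq 2 - (a 0 0 q * a 2 2 q - a 0 2 q * a 2 0 q) * hsum q hq
  have c12 : ∀ q ∈ U, pd 1 (fun q => -(u 1 q * a 2 0 q)) q =
      pd 2 (fun q => u 2 q * a 1 0 q) q := by
    intro q hq
    have e1 := hT.pd_logLame_comm hU hq 1 2 0
    have e2 := hT.pd_logLame hU hq h02.symm h12.symm h01
    rw [pd_neg, pd_mul (du 1 hq) (da 2 0 hq), pd_mul (du 2 hq) (da 1 0 hq), d1 q hq, d2 q hq]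
    linear_combination -a 2 0 q * hrow q hq 1 - a 1 0 q * hrow q hq 2
      + 2 * a 1 0 q * a 2 0 q * hsum q hq - u 1 q * e1 - (u 1 q + u 2 q) * e2
  -- Here g is h₀, so that h₁ = g + u₂ and h₂ = g - u₁. The last two components are the required
  -- ∂₁h₀ and ∂₂h₀; the first is forced by the equation for ∂₀h₁.
  obtain ⟨g, hg, hpd⟩ := exists_potential hU hUs
    ![fun q => -(u 2 q * (a 0 2 q - a 0 0 q)), fun q => u 2 q * a 1 0 q,
      fun q => -(u 1 q * a 2 0 q)]
    (by
      intro i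
      obtain rfl | rfl | rfl := eq_zero_or_one_or_two i
      · exact ((su 2).mul ((sa 0 2).sub (sa 0 0))).neg
      · exact (su 2).mul (sa 1 0)
      · exact ((su 1).mul (sa 2 0)).neg)
    (by
      intro q hq i j
      obtain rfl | rfl | rfl := eq_zero_or_one_or_two i <;>
      obtain rfl | rfl | rfl := eq_zero_or_one_or_two j
      · rfl
      · exact c01 q hq
      · exact c02 q hq
      · exact (c01 q hq).symm
      · rfl
      · exact c12 q hq
      · exact (c02 q hq).symm
      · exact (c12 q hq).symm
      · rfl)
  have dg := fun {q} (hq : q ∈ U) => diffAt_of_smooth hU hg hq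
  have g0 : ∀ q ∈ U, pd 0 g q = -(u 2 q * (a 0 2 q - a 0 0 q)) := fun q hq => hpd q hq 0
  have g1 : ∀ q ∈ U, pd 1 g q = u 2 q * a 1 0 q := fun q hq => hpd q hq 1
  have g2 : ∀ q ∈ U, pd 2 g q = -(u 1 q * a 2 0 q) := fun q hq => hpd q hq 2
  refine ⟨![g, fun q => g q + u 2 q, fun q => g q - u 1 q], ?_, ?_, ?_⟩
  · intro i
    obtain rfl | rfl | rfl := eq_zero_or_one_or_two i
    · exact hg
    · exact hg.add (su 2)
    · exact hg.sub (su 1)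
  · intro q hq i
    obtain rfl | rfl | rfl := eq_zero_or_one_or_two i
    · change g q + u 2 q - g q = u 2 q
      ring
    · change g q - u 1 q - (g q + u 2 q) = u 0 q
      linear_combination -hsum q hq
    · change g q - (g q - u 1 q) = u 1 q
      ring
  · intro q hq i j hij
    obtain rfl | rfl | rfl := eq_zero_or_one_or_two i <;>
    obtain rfl | rfl | rfl := eq_zero_or_one_or_two j
    · exact absurd rfl hij
    · change pd 0 (fun q => g q + u 2 q) q = (g q - (g q + u 2 q)) * a 0 1 q
      rw [pd_add (dg hq) (du 2 hq), g0 q hq, d2 q hq]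
      ring
    · change pd 0 (fun q => g q - u 1 q) q = (g q - (g q - u 1 q)) * a 0 2 q
      rw [pd_sub (dg hq) (du 1 hq), g0 q hq, d1 q hq]
      linear_combination a 0 0 q * hsum q hq - hrow q hq 0
    · change pd 1 g q = (g q + u 2 q - g q) * a 1 0 q
      rw [g1 q hq]
      ring
    · exact absurd rfl hij
    · change pd 1 (fun q => g q - u 1 q) q = (g q + u 2 q - (g q - u 1 q)) * a 1 2 q
      rw [pd_sub (dg hq) (du 1 hq), g1 q hq, d1 q hq]
      linear_combination a 1 0 q * hsum q hq - hrow q hq 1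
    · change pd 2 g q = (g q - u 1 q - g q) * a 2 0 q
      rw [g2 q hq]
      ring
    · change pd 2 (fun q => g q + u 2 q) q = (g q - u 1 q - (g q + u 2 q)) * a 2 1 q
      rw [pd_add (dg hq) (du 2 hq), g2 q hq, d2 q hq]
      linear_combination hrow q hq 2 - a 2 0 q * hsum q hq
    · exact absurd rfl hij

/-- The factor `hᵢ` is stationary along the `xᵢ`-line exactly at the umbilics of `xᵢ = const`. -/
theorem IsAssociatedFactor.pd_self_eq_zero_iff (hU : IsOpen U) (hf : IsGuichardNet U f)
    {h : Fin 3 → E3 → ℝ} (hh : IsAssociatedFactor U f h) (hp : p ∈ U) (i : Fin 3) :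
    pd i (h i) p = 0 ↔ logLame f i (i + 1) p = logLame f i (i + 2) p := by
  have hT := hf.toIsTriplyOrthogonal
  have hij := (add_one_ne i).symm
  have hik := (add_two_ne i).symm
  have hjk := (add_two_ne_add_one i).symm
  have hu := hT.factorDiff_ne_zero hp
  have hsum := hf.sum_factorDiff hp
  have hrow := hf.sum_logLame_mul_factorDiff hU hp i
  rw [sum_distinct hij hik hjk] at hsum hrow
  have h1 : pd i (h i) p = pd i (fun q => h (i + 1) q - factorDiff f (i + 2) q) p :=
    pd_congr_on hU (fun q hq => by rw [← hh.sub_eq q hq]; ring) hp i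
  have h2 : pd i (h i) p =
      -(factorDiff f (i + 2) p * (logLame f i (i + 2) p - logLame f i i p)) := by
    rw [h1, pd_sub (diffAt_of_smooth hU (hh.smooth _) hp)
      (diffAt_of_smooth hU (hT.smooth_factorDiff hU _) hp), hh.pd_eq p hp _ _ hij,
      hT.pd_factorDiff hU hp i hij hik hjk, ← hh.sub_eq p hp]
    ring
  -- What vanishes is a_{i,i+2} - a_ii. With j = i+1 and k = i+2, the two Guichard relations give
  -- uⱼ(a_ij - a_ii) + uₖ(a_ik - a_ii) = 0, where all the u are nonzero and sum to zero.
  rw [h2, neg_eq_zero, mul_eq_zero, or_iff_right (hu _), sub_eq_zero]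
  constructor
  · intro h
    apply mul_left_cancel₀ (hu (i + 1))
    linear_combination hrow - logLame f i i p * hsum + (factorDiff f (i + 1) p) * (-h)
      - (factorDiff f (i + 2) p) * h
  · intro h
    apply mul_left_cancel₀ (hu i)
    linear_combination logLame f i (i + 2) p * hsum - hrow + factorDiff f (i + 1) p * h

end Associated
-- Functions along coordinate lines
section Lines

/-- A line meets a convex set in an interval of parameters. -/
theorem eq_zero_of_hasDerivAt_zero_on_line {F : Type*} [NormedAddCommGroup F] [NormedSpace ℝ F]
    {B : Set E3} (hB : IsOpen B) (hc : Convex ℝ B) {φ : ℝ → F} {x v : E3}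
    (h : ∀ s : ℝ, x + s • v ∈ B → HasDerivAt φ 0 s) {s : ℝ} (hx : x ∈ B) (hs : x + s • v ∈ B) :
    φ s = φ 0 := by
  have hcont : Continuous fun s : ℝ => x + s • v := by fun_prop
  have hconv : Convex ℝ ((fun s : ℝ => x + s • v) ⁻¹' B) := by
    intro a ha b hb α β hα hβ hαβ
    have := hc ha hb hα hβ hαβ
    simp only [Set.mem_preimage]
    convert this using 1
    have : x = (α + β) • x := by rw [hαβ, one_smul]
    conv_lhs => rw [this]
    simp only [smul_eq_mul]
    module
  refine (hB.preimage hcont).is_const_of_deriv_eq_zero hconv.isPreconnected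
    (fun s hs => (h s hs).differentiableAt.differentiableWithinAt) (fun s hs => (h s hs).deriv)
    hs ?_
  simpa using hx

theorem hasDerivAt_line {F : Type*} [NormedAddCommGroup F] [NormedSpace ℝ F] {g : E3 → F}
    {x v : E3} {s : ℝ} (hg : DifferentiableAt ℝ g (x + s • v)) :
    HasDerivAt (fun s : ℝ => g (x + s • v)) (fderiv ℝ g (x + s • v) v) s := by
  refine hg.hasFDerivAt.comp_hasDerivAt s ?_
  simpa using ((hasDerivAt_id s).smul_const v).const_add x

theorem eq_add_single {i : Fin 3} {q q' : E3} (h : ∀ j, j ≠ i → q' j = q j) :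
    q' = q + (q' i - q i) • EuclideanSpace.single i (1 : ℝ) := by
  ext j
  by_cases hj : j = i
  · subst hj; simp
  · simp [hj, h j hj]

theorem add_single_mem_ball {i : Fin 3} {p q : E3} {r : ℝ} (hq : q ∈ Metric.ball p r) :
    p + (q i - p i) • EuclideanSpace.single i (1 : ℝ) ∈ Metric.ball p r := by
  rw [Metric.mem_ball, dist_eq_norm] at hq ⊢
  refine lt_of_le_of_lt ?_ hq
  rw [add_sub_cancel_left, norm_smul]
  simpa using PiLp.norm_apply_le (q - p) i

end Lines

/-! ### Parallel families: Hᵢ depends on xᵢ alone -/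

section Parallel

variable {U : Set E3} {f : E3 → E3} {p : E3}

theorem IsTriplyOrthogonal.logLame_eq_zero_iff (hf : IsTriplyOrthogonal U f)
    (hp : p ∈ U) (i j : Fin 3) : logLame f i j p = 0 ↔ pd i (lame f j) p = 0 := by
  rw [hf.pd_lame hp, mul_eq_zero, or_iff_left (hf.lame_ne_zero hp j)]

/-- The xᵢ-lines are straight: the component of ∂ᵢ²f along ∂ⱼf is governed by a_ji. -/
theorem IsTriplyOrthogonal.pd_pd_self_of_parallel (hU : IsOpen U) (hf : IsTriplyOrthogonal U f)
    {i : Fin 3} (hp : p ∈ U) (h : ∀ j, j ≠ i → logLame f j i p = 0) :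
    pd i (pd i f) p = logLame f i i p • pd i f p := by
  refine hf.ext_inner hp fun j => ?_
  rw [inner_smul_left, conj_trivial]
  by_cases hj : j = i
  · subst hj
    rw [hf.inner_pd_pd hU hp, hf.inner_pd_pd_self hp]
  · rw [hf.inner_pd_pd_of_ne hU hp hj, h j hj, hf.orthogonal p hp i j (Ne.symm hj)]
    ring

theorem IsTriplyOrthogonal.pd_unitNormal_of_parallel (hU : IsOpen U) (hf : IsTriplyOrthogonal U f)
    {i : Fin 3} (hp : p ∈ U) (h : ∀ j, j ≠ i → logLame f j i p = 0) :
    pd i (unitNormal f i) p = 0 := by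
  have h1 := hf.pd_pd_self_of_parallel hU hp h
  have h2 : pd i (pd i f) p = pd i (fun q => lame f i q • unitNormal f i q) p :=
    pd_congr_on hU (fun q hq => hf.pd_eq hq i) hp i
  rw [h2, pd_smul (diffAt_of_smooth hU (hf.smooth_lame hU i) hp)
    (diffAt_of_smooth hU (hf.smooth_unitNormal hU i) hp), hf.pd_lame hp, ← smul_smul,
    ← hf.pd_eq hp, add_eq_left, smul_eq_zero, or_iff_right (hf.lame_ne_zero hp i)] at h1
  exact h1

theorem IsTriplyOrthogonal.logLame_eq_zero_of_parallel (hU : IsOpen U)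
    (hf : IsTriplyOrthogonal U f) {i j : Fin 3} (hji : j ≠ i) (h : IsParallelFamily U f i)
    (hp : p ∈ U) : logLame f j i p = 0 := by
  rw [hf.logLame_eq_zero_iff hp]
  obtain ⟨r, hr, hrU, t, ht⟩ := h p hp
  have hball := Metric.isOpen_ball (x := p) (ε := r)
  -- Pairing the parallelism relation with Nᵢ(q) recovers the distance, whose rate at zero
  -- displacement is Hᵢ(q). Since the distance depends on q only through its i-th coordinate, so
  -- does Hᵢ.
  have hdist : ∀ q ∈ Metric.ball p r, HasDerivAt (fun s => t (q i) (q i + s)) (lame f i q) 0 := by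
    intro q hq
    have hd := hasDerivAt_line (g := f) (x := q) (v := EuclideanSpace.single i (1 : ℝ)) (s := 0)
      (by simpa using diffAt_of_smooth hU hf.smooth (hrU hq))
    have hd' := (hd.sub_const (f q)).inner ℝ (hasDerivAt_const (0 : ℝ) (unitNormal f i q))
    simp only [zero_smul, add_zero, inner_zero_right, zero_add] at hd'
    refine HasDerivAt.congr_of_eventuallyEq (f := _) hd' ?_
    have hnear : ∀ᶠ s : ℝ in nhds 0,
        q + s • EuclideanSpace.single i (1 : ℝ) ∈ Metric.ball p r := by
      refine (Continuous.tendsto ?_ 0).eventually (hball.mem_nhds ?_)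
      · fun_prop
      · simpa using hq
    filter_upwards [hnear] with s hs
    have e := ht q hq _ hs fun j hj => by simp [hj]
    rw [e, add_sub_cancel_left, inner_smul_left, real_inner_self_eq_norm_sq,
      hf.norm_unitNormal (hrU hq)]
    simp
  have hconst : ∀ᶠ s : ℝ in nhds 0,
      lame f i (p + s • EuclideanSpace.single j (1 : ℝ)) = lame f i p := by
    have hnear : ∀ᶠ s : ℝ in nhds 0,
        p + s • EuclideanSpace.single j (1 : ℝ) ∈ Metric.ball p r := by
      refine (Continuous.tendsto ?_ 0).eventually (hball.mem_nhds ?_)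
      · fun_prop
      · simpa using hr
    filter_upwards [hnear] with s hs
    have h1 := hdist _ hs
    have h2 := hdist p (Metric.mem_ball_self hr)
    have e : (p + s • EuclideanSpace.single j (1 : ℝ)) i = p i := by simp [hji.symm]
    rw [e] at h1
    exact h1.unique h2
  have hd := hasDerivAt_line (g := lame f i) (x := p) (v := EuclideanSpace.single j (1 : ℝ))
    (s := 0) (by simpa using diffAt_of_smooth hU (hf.smooth_lame hU i) hp)
  have hd0 : HasDerivAt (fun s : ℝ => lame f i (p + s • EuclideanSpace.single j (1 : ℝ))) 0 0 :=
    (hasDerivAt_const (0 : ℝ) (lame f i p)).congr_of_eventuallyEq hconst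
  have := hd.unique hd0
  simpa [pd] using this

/-- The normal Nᵢ is constant along each xᵢ-line and the speed Hᵢ is the same on all of them, so
corresponding points of two surfaces are equally far apart. -/
theorem IsTriplyOrthogonal.isParallelFamily (hU : IsOpen U)
    (hf : IsTriplyOrthogonal U f) {i : Fin 3}
    (h : ∀ p ∈ U, ∀ j, j ≠ i → logLame f j i p = 0) : IsParallelFamily U f i := by
  intro p hp
  obtain ⟨r, hr, hrU⟩ := Metric.isOpen_iff.1 hU p hp
  have hB := Metric.isOpen_ball (x := p) (ε := r)
  have hC := convex_ball p r
  set e : E3 := EuclideanSpace.single i (1 : ℝ) with he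
  have hN : ∀ q ∈ Metric.ball p r, ∀ s : ℝ, q + s • e ∈ Metric.ball p r →
      unitNormal f i (q + s • e) = unitNormal f i q := by
    intro q hq s hs
    have := eq_zero_of_hasDerivAt_zero_on_line hB hC
      (φ := fun s => unitNormal f i (q + s • e)) (fun s hs => by
        have hz := hf.pd_unitNormal_of_parallel hU (hrU hs) (h _ (hrU hs))
        have := hasDerivAt_line (diffAt_of_smooth hU (hf.smooth_unitNormal hU i) (hrU hs))
        rwa [show fderiv ℝ (unitNormal f i) (q + s • e) e = 0 from hz] at this) hq hs
    simpa using this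
  have hH : ∀ q ∈ Metric.ball p r, ∀ q' ∈ Metric.ball p r, q i = q' i →
      lame f i q' = lame f i q := by
    intro q hq q' hq' hi
    have := eq_zero_of_hasDerivAt_zero_on_line hB hC (x := q) (v := q' - q) (s := 1)
      (φ := fun s => lame f i (q + s • (q' - q))) (fun s hs => by
        have := hasDerivAt_line (diffAt_of_smooth hU (hf.smooth_lame hU i) (hrU hs))
        convert this using 1
        rw [euclidean_eq_sum (q' - q), map_sum]
        refine (Finset.sum_eq_zero fun m _ => ?_).symm
        rw [map_smul]
        by_cases hm : m = i
        · subst hm; simp [hi]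
        · have hz := (hf.logLame_eq_zero_iff (hrU hs) m i).1 (h _ (hrU hs) m hm)
          rw [← euclidean_eq_sum]
          exact smul_eq_zero_of_right _ hz) hq (by simpa using hq')
    simpa using this
  -- The distance is measured on the xᵢ-line through the centre p; p' below is the point of that
  -- line with the i-th coordinate of q.
  refine ⟨r, hr, hrU, fun a b => ⟪f (p + (b - p i) • e) - f (p + (a - p i) • e),
    unitNormal f i p⟫_ℝ, fun q hq q' hq' hqq' => ?_⟩
  have hq'_eq := eq_add_single hqq'
  rw [← he] at hq'_eq
  set p' := p + (q i - p i) • e with hp'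
  have hmem : ∀ s : ℝ, q + s • e ∈ Metric.ball p r → p' + s • e ∈ Metric.ball p r := by
    intro s hs
    have := add_single_mem_ball (i := i) hs
    rw [← he] at this
    convert this using 1
    simp only [hp', he]
    simp
    module
  have hp0 : p' ∈ Metric.ball p r := add_single_mem_ball hq
  -- The motion from q minus the motion from p', redirected along Nᵢ(q), has zero velocity.
  have hφ := eq_zero_of_hasDerivAt_zero_on_line hB hC (x := q) (v := e) (s := q' i - q i)
    (φ := fun s => f (q + s • e) - ⟪f (p' + s • e) - f p', unitNormal f i p⟫_ℝ • unitNormal f i q)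
    (fun s hs => by
      have d1 := hasDerivAt_line (diffAt_of_smooth hU hf.smooth (hrU hs))
      have d2 := hasDerivAt_line (diffAt_of_smooth hU hf.smooth (hrU (hmem s hs)))
      have d3 := ((d2.sub_const (f p')).inner ℝ
        (hasDerivAt_const s (unitNormal f i p))).smul_const (unitNormal f i q)
      have e1 : fderiv ℝ f (q + s • e) e = lame f i (q + s • e) • unitNormal f i q := by
        rw [← hN q hq s hs]
        exact hf.pd_eq (hrU hs) i
      have e2 : fderiv ℝ f (p' + s • e) e = lame f i (q + s • e) • unitNormal f i p := by
        rw [← hN p (Metric.mem_ball_self hr) _ hp0, ← hp', ← hN p' hp0 s (hmem s hs),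
          hH _ (hmem s hs) _ hs (by simp [hp', he])]
        exact hf.pd_eq (hrU (hmem s hs)) i
      have d4 := d1.sub d3
      rw [e1, e2, inner_zero_right, zero_add, inner_smul_left, real_inner_self_eq_norm_sq,
        hf.norm_unitNormal hp] at d4
      simp only [conj_trivial, one_pow, mul_one, sub_self] at d4
      exact d4) hq (by rw [← hq'_eq]; exact hq')
  simp only [← hq'_eq] at hφ
  have hp'2 : p' + (q' i - q i) • e = p + (q' i - p i) • e := by
    simp only [hp']; module
  rw [hp'2] at hφ
  simp only [zero_smul, add_zero, sub_self, inner_zero_left, sub_zero] at hφ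
  rw [← hφ]
  abel

end Parallel
-- Curvatures and channel condition under Combescure transforms
section Channel

variable {U : Set E3} {f fhat : E3 → E3} {p : E3} {h : Fin 3 → E3 → ℝ}

theorem normalVector_combescure (hfhat : ∀ i, pd i fhat p = h i p • pd i f p) (i : Fin 3) :
    normalVector fhat i p = (h (i + 1) p * h (i + 2) p) • normalVector f i p := by
  rw [normalVector, hfhat, hfhat, cross_smul_smul, normalVector]

/-- Rescaling the tangent vectors can only flip the normal; at degenerate points both sides are 0
because ‖0‖⁻¹ = 0. -/
theorem unitNormal_combescure (hfhat : ∀ i, pd i fhat p = h i p • pd i f p) (i : Fin 3) :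
    unitNormal fhat i p = (SignType.sign (h (i + 1) p * h (i + 2) p) : ℝ) • unitNormal f i p := by
  have key : ∀ c : ℝ, |c|⁻¹ * c = (SignType.sign c : ℝ) := by
    intro c
    by_cases hc : c = 0
    · simp [hc]
    · rw [inv_mul_eq_iff_eq_mul₀ (abs_ne_zero.2 hc), abs_mul_sign]
  rw [unitNormal, normalVector_combescure hfhat, norm_smul, unitNormal, smul_smul, smul_smul,
    ← key, Real.norm_eq_abs, mul_inv]
  ring_nf

theorem principalCurvature_combescure (hU : IsOpen U) (hf : IsTriplyOrthogonal U f)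
    (hh : ∀ i, ContDiffOn ℝ ∞ (h i) U) (hfhat : ∀ p ∈ U, ∀ i, pd i fhat p = h i p • pd i f p)
    (hp : p ∈ U) {i j : Fin 3} (hij : i ≠ j) :
    principalCurvature fhat i j p =
      (SignType.sign (h (i + 1) p * h (i + 2) p) : ℝ) * (principalCurvature f i j p / h j p) := by
  have h1 : pd j (pd j fhat) p = pd j (fun q => h j q • pd j f q) p :=
    pd_congr_on hU (fun q hq => hfhat q hq j) hp j
  rw [principalCurvature, h1, pd_smul (diffAt_of_smooth hU (hh j) hp)
    (diffAt_of_smooth hU (smooth_pd hU hf.smooth j) hp), unitNormal_combescure (hfhat p hp),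
    hfhat p hp, principalCurvature, norm_smul, Real.norm_eq_abs, mul_pow, sq_abs]
  have h0 : ⟪pd j f p, unitNormal f i p⟫_ℝ = 0 := by
    rw [hf.unitNormal_eq hp, inner_smul_right, hf.orthogonal p hp _ _ hij.symm, mul_zero]
  simp only [inner_add_left, inner_smul_left, inner_smul_right, h0, conj_trivial]
  by_cases hj : h j p = 0
  · simp [hj]
  · have := norm_ne_zero_iff.2 (hf.pd_ne_zero hp j)
    field_simp
    ring

/-- The channel condition for a Combescure transform, in terms of the original system. -/
theorem pd_principalCurvature_combescure_eq_zero_iff (hU : IsOpen U) (hf : IsTriplyOrthogonal U f)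
    (hh : ∀ i, ContDiffOn ℝ ∞ (h i) U) (hfhat : ∀ p ∈ U, ∀ i, pd i fhat p = h i p • pd i f p)
    (hp : p ∈ U) {i j : Fin 3} (hji : j ≠ i) (h0 : h (j + 1) p * h (j + 2) p ≠ 0) :
    pd i (principalCurvature fhat j i) p = 0 ↔
      pd i (principalCurvature f j i) p * h i p = principalCurvature f j i p * pd i (h i) p := by
  have hi : h i p ≠ 0 := by
    rcases eq_add_one_or_two hji.symm with rfl | rfl
    · exact left_ne_zero_of_mul h0
    · exact right_ne_zero_of_mul h0
  have dh := fun l => diffAt_of_smooth hU (hh l) hp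
  have dκ := diffAt_of_smooth hU (hf.smooth_principalCurvature hU hji) hp
  have hdc : DifferentiableAt ℝ (fun q => principalCurvature f j i q / h i q) p :=
    diffAt_div dκ (dh i) hi
  have hs0 : (SignType.sign (h (j + 1) p * h (j + 2) p) : ℝ) ≠ 0 := by
    rcases lt_or_gt_of_ne h0 with h1 | h1
    · simp [sign_neg h1]
    · simp [sign_pos h1]
  -- Near an immersed point the orientation sign is constant, so it drops out of the derivative.
  have hsign : ∀ᶠ q in nhds p, SignType.sign (h (j + 1) q * h (j + 2) q) =
      SignType.sign (h (j + 1) p * h (j + 2) p) := by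
    have hc : ContinuousAt (fun q => h (j + 1) q * h (j + 2) q) p :=
      ((dh _).fun_mul (dh _)).continuousAt
    rcases lt_or_gt_of_ne h0 with h1 | h1
    · filter_upwards [hc.eventually_lt_const h1] with q hq
      rw [sign_neg hq, sign_neg h1]
    · filter_upwards [hc.eventually_const_lt h1] with q hq
      rw [sign_pos hq, sign_pos h1]
  have hev : principalCurvature fhat j i =ᶠ[nhds p] fun q =>
      (SignType.sign (h (j + 1) p * h (j + 2) p) : ℝ) * (principalCurvature f j i q / h i q) := by
    filter_upwards [hsign, hU.mem_nhds hp] with q hq hqU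
    rw [principalCurvature_combescure hU hf hh hfhat hqU hji, hq]
  rw [pd_congr hev, pd_mul (differentiableAt_const _) hdc, pd_const, zero_mul, zero_add,
    mul_eq_zero, or_iff_right hs0, pd_div dκ (dh i) hi, div_eq_zero_iff,
    or_iff_left (pow_ne_zero 2 hi), sub_eq_zero]

end Channel

/-! ### Umbilic families, and the global choice between parallel and umbilic -/

section Dichotomy

variable {U : Set E3} {f : E3 → E3} {p : E3}

theorem IsTriplyOrthogonal.principalCurvature_eq_zero_iff (hU : IsOpen U)
    (hf : IsTriplyOrthogonal U f) (hp : p ∈ U) {i j : Fin 3} (hij : i ≠ j) :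
    principalCurvature f i j p = 0 ↔ logLame f i j p = 0 := by
  rw [hf.principalCurvature_eq hU hp hij, div_eq_zero_iff, or_iff_left (hf.lame_ne_zero hp i),
    neg_eq_zero]

theorem IsGuichardNet.logLame_self_of_umbilic (hU : IsOpen U) (hf : IsGuichardNet U f)
    (hp : p ∈ U) {i j k : Fin 3} (hij : i ≠ j) (hik : i ≠ k) (hjk : j ≠ k)
    (h : logLame f i j p = logLame f i k p) : logLame f i i p = logLame f i k p := by
  have hsum := hf.sum_factorDiff hp
  have hrow := hf.sum_logLame_mul_factorDiff hU hp i
  rw [sum_distinct hij hik hjk] at hsum hrow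
  apply mul_right_cancel₀ (hf.toIsTriplyOrthogonal.factorDiff_ne_zero hp i)
  linear_combination hrow - logLame f i k p * hsum - factorDiff f j p * h

/-- Umbilicity and the Guichard relations give a_ii = a_ik. Differentiated in xⱼ, this and a Lamé
equation yield ∂ᵢa_ji = a_ji a_ij, which says that a_ji/Hⱼ is constant along the xᵢ-lines. -/
theorem IsGuichardNet.pd_principalCurvature_of_umbilic (hU : IsOpen U) (hf : IsGuichardNet U f)
    {i j k : Fin 3} (hij : i ≠ j) (hik : i ≠ k) (hjk : j ≠ k)
    (h : ∀ p ∈ U, logLame f i j p = logLame f i k p) (hp : p ∈ U) :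
    pd i (principalCurvature f j i) p = 0 := by
  have hT := hf.toIsTriplyOrthogonal
  have h1 : pd i (principalCurvature f j i) p =
      pd i (fun q => -logLame f j i q / lame f j q) p :=
    pd_congr_on hU (fun q hq => hT.principalCurvature_eq hU hq hij.symm) hp i
  have h2 : pd j (logLame f i i) p = pd j (logLame f i k) p :=
    pd_congr_on hU (fun q hq => hf.logLame_self_of_umbilic hU hq hij hik hjk (h q hq)) hp j
  rw [hT.pd_logLame_comm hU hp, hT.pd_logLame hU hp hjk hij.symm hik.symm] at h2
  have hj := hT.lame_ne_zero hp j
  rw [h1, pd_div (diffAt_of_smooth hU (hT.smooth_logLame hU j i) hp).fun_neg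
    (diffAt_of_smooth hU (hT.smooth_lame hU j) hp) hj, pd_neg, h2, hT.pd_lame hp, h p hp]
  field_simp
  ring

/-- A Gauss equation for a family of parallel surfaces. -/
theorem IsTriplyOrthogonal.pd_logLame_of_parallel (hU : IsOpen U) (hf : IsTriplyOrthogonal U f)
    {i : Fin 3} (hp : p ∈ U) (h : ∀ᶠ q in nhds p, ∀ j, j ≠ i → logLame f j i q = 0)
    {j : Fin 3} (hji : j ≠ i) :
    pd i (logLame f i j) p = logLame f i i p * logLame f i j p - logLame f i j p ^ 2 := by
  have dX := fun l => diffAt_of_smooth hU (smooth_pd hU hf.smooth l) hp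
  have da := fun l m => diffAt_of_smooth hU (hf.smooth_logLame hU l m) hp
  have h1 : pd j (pd i (pd i f)) p = pd j (fun q => logLame f i i q • pd i f q) p := by
    refine pd_congr ?_ j
    filter_upwards [h, hU.mem_nhds hp] with q hq hqU
    exact hf.pd_pd_self_of_parallel hU hqU hq
  have h2 : pd i (pd j (pd i f)) p = pd i (fun q => logLame f i j q • pd j f q) p := by
    refine pd_congr ?_ i
    filter_upwards [h, hU.mem_nhds hp] with q hq hqU
    rw [hf.pd_pd hU hqU hji, hq j hji, zero_smul, zero_add]
  rw [pd_comm hU (smooth_pd hU hf.smooth i) hp, h2, pd_smul (da _ _) (dX _),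
    pd_smul (da _ _) (dX _), hf.pd_pd hU hp hji, hf.pd_pd hU hp hji.symm] at h1
  have h3 := congrArg (fun v => ⟪v, pd j f p⟫_ℝ) h1
  simp only [inner_add_left, inner_smul_left, conj_trivial, hf.orthogonal p hp _ _ hji.symm,
    hf.inner_pd_pd_self hp] at h3
  apply mul_right_cancel₀ (pow_ne_zero 2 (hf.lame_ne_zero hp j))
  linear_combination h3

/-- Measures the deviation of the surfaces `xᵢ = const` from being totally umbilic. -/
noncomputable def umbilicDefect (f : E3 → E3) (i j k : Fin 3) (q : E3) : ℝ :=
  (logLame f i j q - logLame f i k q) * (lame f j q * lame f k q / lame f i q)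

theorem IsTriplyOrthogonal.smooth_umbilicDefect (hU : IsOpen U) (hf : IsTriplyOrthogonal U f)
    (i j k : Fin 3) : ContDiffOn ℝ ∞ (umbilicDefect f i j k) U :=
  ((hf.smooth_logLame hU i j).sub (hf.smooth_logLame hU i k)).mul
    (((hf.smooth_lame hU j).mul (hf.smooth_lame hU k)).div (hf.smooth_lame hU i)
      fun _ hp => hf.lame_ne_zero hp i)

theorem IsTriplyOrthogonal.umbilicDefect_eq_zero_iff (hf : IsTriplyOrthogonal U f) (hp : p ∈ U)
    (i j k : Fin 3) : umbilicDefect f i j k p = 0 ↔ logLame f i j p = logLame f i k p := by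
  rw [umbilicDefect, mul_eq_zero, or_iff_left, sub_eq_zero]
  exact div_ne_zero (mul_ne_zero (hf.lame_ne_zero hp j) (hf.lame_ne_zero hp k))
    (hf.lame_ne_zero hp i)

theorem IsTriplyOrthogonal.pd_umbilicDefect (hU : IsOpen U) (hf : IsTriplyOrthogonal U f)
    (hp : p ∈ U) (i j k m : Fin 3) : pd m (umbilicDefect f i j k) p =
      (pd m (logLame f i j) p - pd m (logLame f i k) p + (logLame f i j p - logLame f i k p) *
        (logLame f m j p + logLame f m k p - logLame f m i p)) *
        (lame f j p * lame f k p / lame f i p) := by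
  have dH := fun l => diffAt_of_smooth hU (hf.smooth_lame hU l) hp
  have da := fun l m => diffAt_of_smooth hU (hf.smooth_logLame hU l m) hp
  have hi := hf.lame_ne_zero hp i
  change pd m (fun q => (logLame f i j q - logLame f i k q) *
    (lame f j q * lame f k q / lame f i q)) p = _
  rw [pd_mul ((da i j).fun_sub (da i k)) (diffAt_div ((dH j).fun_mul (dH k)) (dH i) hi),
    pd_sub (da _ _) (da _ _), pd_div ((dH j).fun_mul (dH k)) (dH i) hi, pd_mul (dH j) (dH k),
    hf.pd_lame hp, hf.pd_lame hp, hf.pd_lame hp]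
  field_simp

/-- Differentiate Σ a_il u_l = 0 in xⱼ: parallelism removes ∂ⱼa_ii = ∂ᵢa_ji, a Lamé equation gives
∂ⱼa_ik, so ∂ⱼa_ij is determined. The weight HⱼHₖ/Hᵢ is the integrating factor that turns the result
into a vanishing derivative. -/
theorem IsGuichardNet.pd_umbilicDefect_of_parallel (hU : IsOpen U) (hf : IsGuichardNet U f)
    (hp : p ∈ U) {i j k : Fin 3} (hij : i ≠ j) (hik : i ≠ k) (hjk : j ≠ k)
    (h : ∀ᶠ q in nhds p, ∀ j, j ≠ i → logLame f j i q = 0) :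
    pd j (umbilicDefect f i j k) p = 0 := by
  have hT := hf.toIsTriplyOrthogonal
  have da := fun l m => diffAt_of_smooth hU (hT.smooth_logLame hU l m) hp
  have du := fun l => diffAt_of_smooth hU (hT.smooth_factorDiff hU l) hp
  have hrow : ∀ q ∈ U, ∀ m, logLame f m i q * factorDiff f i q + logLame f m j q * factorDiff f j q
      + logLame f m k q * factorDiff f k q = 0 := fun q hq m => by
    rw [← hf.sum_logLame_mul_factorDiff hU hq m, sum_distinct hij hik hjk]
  have h1 : pd j (fun q => logLame f i i q * factorDiff f i q + logLame f i j q * factorDiff f j q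
      + logLame f i k q * factorDiff f k q) p = pd j (fun _ => (0 : ℝ)) p :=
    pd_congr_on hU (fun q hq => hrow q hq i) hp j
  rw [pd_const, pd_add (((da _ _).fun_mul (du _)).fun_add ((da _ _).fun_mul (du _)))
    ((da _ _).fun_mul (du _)), pd_add ((da _ _).fun_mul (du _)) ((da _ _).fun_mul (du _)),
    pd_mul (da _ _) (du _), pd_mul (da _ _) (du _), pd_mul (da _ _) (du _),
    hT.pd_factorDiff hU hp j hij hik hjk, hT.pd_factorDiff hU hp j hik hij hjk.symm,
    hT.pd_factorDiff hU hp j hjk hij.symm hik.symm, hT.pd_logLame_comm hU hp j i i] at h1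
  have h2 : pd i (logLame f j i) p = 0 := by
    rw [← pd_const (p := p) (0 : ℝ) i]
    exact pd_congr (h.mono fun q hq => hq j hij.symm) i
  have h3 : logLame f j i p = 0 := h.self_of_nhds j hij.symm
  have h4 := hT.pd_logLame hU hp hjk hij.symm hik.symm
  have h5 := hrow p hp i
  have h6 := hrow p hp j
  rw [hT.pd_umbilicDefect hU hp, mul_eq_zero]
  left
  apply mul_left_cancel₀ (hT.factorDiff_ne_zero hp j)
  rw [h2, h4, h3] at h1
  rw [h3] at h6
  rw [h4, h3]
  linear_combination h1 + (logLame f j j p + logLame f j k p) * h5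
    - (logLame f i j p + logLame f i k p) * h6

/-- The xᵢ-derivative vanishes by the Gauss equations for j and k; the other two directions agree up
to the antisymmetry of the defect in j and k. -/
theorem IsGuichardNet.pd_umbilicDefect_eq_zero_of_parallel (hU : IsOpen U)
    (hf : IsGuichardNet U f) (hp : p ∈ U) {i j k : Fin 3} (hij : i ≠ j) (hik : i ≠ k) (hjk : j ≠ k)
    (h : ∀ᶠ q in nhds p, ∀ j, j ≠ i → logLame f j i q = 0) (m : Fin 3) :
    pd m (umbilicDefect f i j k) p = 0 := by
  have hT := hf.toIsTriplyOrthogonal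
  rcases eq_or_eq_or_eq hij hik hjk m with rfl | rfl | rfl
  · rw [hT.pd_umbilicDefect hU hp, hT.pd_logLame_of_parallel hU hp h hij.symm,
      hT.pd_logLame_of_parallel hU hp h hik.symm, mul_eq_zero]
    left
    ring
  · exact hf.pd_umbilicDefect_of_parallel hU hp hij hik hjk h
  · have h1 : umbilicDefect f i j m = fun q => -umbilicDefect f i m j q :=
      funext fun q => by simp only [umbilicDefect]; ring
    rw [h1, pd_neg, hf.pd_umbilicDefect_of_parallel hU hp hik hij hjk.symm h, neg_zero]

/-- If every point is either a point where the surfaces `xᵢ = const` are infinitesimally parallel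
or an umbilic of them, then one of the alternatives holds throughout the connected domain. -/
theorem IsGuichardNet.parallel_or_umbilic (hU : IsOpen U) (hUc : IsPreconnected U)
    (hf : IsGuichardNet U f) {i j k : Fin 3} (hij : i ≠ j) (hik : i ≠ k) (hjk : j ≠ k)
    (h : ∀ p ∈ U, (∀ l, l ≠ i → logLame f l i p = 0) ∨ logLame f i j p = logLame f i k p) :
    (∀ p ∈ U, ∀ l, l ≠ i → logLame f l i p = 0) ∨
      ∀ p ∈ U, logLame f i j p = logLame f i k p := by
  have hT := hf.toIsTriplyOrthogonal
  have hD := hT.smooth_umbilicDefect hU i j k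
  -- If the gradient were nonzero at p, it would be nonzero nearby. A nearby non-parallel point has
  -- a neighbourhood of umbilics, where the defect is identically zero, a contradiction; so p has a
  -- parallel neighbourhood, where the gradient vanishes after all.
  have hzero : ∀ p ∈ U, ∀ m, pd m (umbilicDefect f i j k) p = 0 := by
    intro p hp m
    by_contra hne
    have hev : ∀ᶠ q in nhds p, pd m (umbilicDefect f i j k) q ≠ 0 :=
      (diffAt_of_smooth hU (smooth_pd hU hD m) hp).continuousAt.eventually_ne hne
    refine hne (hf.pd_umbilicDefect_eq_zero_of_parallel hU hp hij hik hjk ?_ m)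
    filter_upwards [hev, hU.mem_nhds hp] with q hq hqU l hl
    by_contra hl0
    apply hq
    rw [← pd_const (p := q) (0 : ℝ) m]
    refine pd_congr ?_ m
    filter_upwards [(diffAt_of_smooth hU (hT.smooth_logLame hU l i) hqU).continuousAt.eventually_ne
      hl0, hU.mem_nhds hqU] with x hx hxU
    rw [hT.umbilicDefect_eq_zero_iff hxU]
    exact (h x hxU).resolve_left fun h' => hx (h' l hl)
  by_cases hu : ∀ p ∈ U, logLame f i j p = logLame f i k p
  · exact Or.inr hu
  · push Not at hu
    obtain ⟨p₀, hp₀, h₀⟩ := hu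
    -- The defect is a nonzero constant, so no point is umbilic.
    refine Or.inl fun p hp => (h p hp).resolve_right fun h' => h₀ ?_
    rw [← hT.umbilicDefect_eq_zero_iff hp₀,
      eq_of_pd_eq_zero hU hUc (fun q hq => diffAt_of_smooth hU hD hq) hzero hp₀ hp,
      hT.umbilicDefect_eq_zero_iff hp, h']

end Dichotomy

/-! ### Cyclicity of the associated systems -/

section Cyclic

variable {U : Set E3} {f : E3 → E3}

theorem IsGuichardNet.isCyclic_of_parallel (hU : IsOpen U) (hf : IsGuichardNet U f) {i : Fin 3}
    (h : IsParallelFamily U f i) {fhat : E3 → E3} (hfhat : IsAssociatedSystem U f fhat) :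
    IsCyclic U fhat := by
  have hT := hf.toIsTriplyOrthogonal
  obtain ⟨g, hg, hgf⟩ := hfhat.exists_factor hU hT
  refine ⟨i, fun j hji p hp hn => ?_⟩
  rw [normalVector_combescure (hgf p hp), smul_ne_zero_iff] at hn
  rw [pd_principalCurvature_combescure_eq_zero_iff hU hT hg.smooth hgf hp hji hn.1]
  have hκ : ∀ q ∈ U, principalCurvature f j i q = 0 := fun q hq =>
    (hT.principalCurvature_eq_zero_iff hU hq hji).2 (hT.logLame_eq_zero_of_parallel hU hji h hq)
  rw [hκ p hp, pd_congr_on hU hκ hp, pd_const, zero_mul, zero_mul]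

theorem IsGuichardNet.isCyclic_of_umbilic (hU : IsOpen U) (hf : IsGuichardNet U f) {i : Fin 3}
    (h : IsTotallyUmbilicFamily U f i) {fhat : E3 → E3} (hfhat : IsAssociatedSystem U f fhat) :
    IsCyclic U fhat := by
  have hT := hf.toIsTriplyOrthogonal
  obtain ⟨g, hg, hgf⟩ := hfhat.exists_factor hU hT
  refine ⟨i, fun j hji p hp hn => ?_⟩
  rw [normalVector_combescure (hgf p hp), smul_ne_zero_iff] at hn
  rw [pd_principalCurvature_combescure_eq_zero_iff hU hT hg.smooth hgf hp hji hn.1]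
  obtain ⟨k, hik, hjk⟩ := exists_third hji.symm
  have hu := (hT.isTotallyUmbilicFamily_iff hU hji.symm hik hjk).1 h
  have hu' := (hT.isTotallyUmbilicFamily_iff hU (add_one_ne i).symm (add_two_ne i).symm
    (add_two_ne_add_one i).symm).1 h
  rw [hf.pd_principalCurvature_of_umbilic hU hji.symm hik hjk hu hp,
    (hg.pd_self_eq_zero_iff hU hf hp i).2 (hu' p hp), zero_mul, mul_zero]

theorem IsGuichardNet.exists_index_of_isCyclic (hU : IsOpen U) (hf : IsGuichardNet U f)
    {g : Fin 3 → E3 → ℝ} (hg : IsAssociatedFactor U f g) {fhat : E3 → E3}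
    (hs : ContDiffOn ℝ ∞ fhat U) (hgf : ∀ p ∈ U, ∀ i, pd i fhat p = g i p • pd i f p)
    (h : ∀ c : ℝ, IsCyclic U fun q => fhat q + c • f q) :
    ∃ i, ∀ p ∈ U, ∀ j, j ≠ i → principalCurvature f j i p * pd i (g i) p = 0 := by
  have hT := hf.toIsTriplyOrthogonal
  choose idx hidx using h
  -- Pigeonhole over the real parameter c, before any point is fixed: i does not depend on p.
  obtain ⟨i, hi⟩ := Finite.exists_infinite_fiber idx
  refine ⟨i, fun p hp j hji => ?_⟩
  have hinf : (idx ⁻¹' {i}).Infinite := Set.infinite_coe_iff.1 hi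
  -- Discard the values of c for which the surface xⱼ = const of f̂ + c·f is not immersed at p.
  have hinf' := hinf.sdiff (Set.toFinite {-g (j + 1) p, -g (j + 2) p})
  have key : ∀ c ∈ idx ⁻¹' {i} \ {-g (j + 1) p, -g (j + 2) p},
      pd i (principalCurvature f j i) p * (g i p + c) =
        principalCurvature f j i p * pd i (g i) p := by
    rintro c ⟨hc, hc'⟩
    have hc : idx c = i := hc
    simp only [Set.mem_insert_iff, Set.mem_singleton_iff, not_or] at hc'
    have hgf' : ∀ p ∈ U, ∀ i, pd i (fun q => fhat q + c • f q) p = (g i p + c) • pd i f p := by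
      intro p hp i
      have df := diffAt_of_smooth hU hT.smooth hp
      rw [pd_add (diffAt_of_smooth hU hs hp) ((differentiableAt_const c).fun_smul df),
        pd_smul (differentiableAt_const c) df, pd_const, zero_smul, zero_add, hgf p hp, add_smul]
    have h0 : (g (j + 1) p + c) * (g (j + 2) p + c) ≠ 0 :=
      mul_ne_zero (fun h => hc'.1 (by linarith)) (fun h => hc'.2 (by linarith))
    have hch := hidx c j (hc ▸ hji) p hp (by
      rw [normalVector_combescure (h := fun i q => g i q + c) (hgf' p hp)]
      exact smul_ne_zero h0 (hT.normalVector_ne_zero hp j))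
    rw [hc, pd_principalCurvature_combescure_eq_zero_iff hU hT (hg.add_const hU c).smooth hgf' hp
      hji h0, pd_add (diffAt_of_smooth hU (hg.smooth i) hp) (differentiableAt_const c), pd_const,
      add_zero] at hch
    exact hch
  -- The channel equation is affine in c, so two parameters make both of its sides vanish.
  obtain ⟨c, hc, c', hc', hne⟩ := hinf'.nontrivial
  have h1 := key c hc
  have h2 := key c' hc'
  have h3 : pd i (principalCurvature f j i) p = 0 := by
    apply mul_right_cancel₀ (sub_ne_zero.2 hne)
    linear_combination h1 - h2
  rw [← h1, h3, zero_mul]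

end Cyclic

end GuichardNet

/-! ### The main theorem -/

theorem mainTheorem8 (U : Set GuichardNet.E3) (hU : IsOpen U) (hUs : IsSimplyConnected U)
    (f : GuichardNet.E3 → GuichardNet.E3) (hf : GuichardNet.IsGuichardNet U f) :
    (∃ i : Fin 3, GuichardNet.IsParallelFamily U f i ∨
        GuichardNet.IsTotallyUmbilicFamily U f i) ↔
      ∀ fhat : GuichardNet.E3 → GuichardNet.E3,
        GuichardNet.IsAssociatedSystem U f fhat → GuichardNet.IsCyclic U fhat := by
  have hT := hf.toIsTriplyOrthogonal
  constructor
  · rintro ⟨i, h | h⟩ fhat hfhat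
    · exact hf.isCyclic_of_parallel hU h hfhat
    · exact hf.isCyclic_of_umbilic hU h hfhat
  · intro h
    obtain ⟨g, hg⟩ := hf.exists_factor hU hUs
    obtain ⟨fhat, hs, hgf⟩ := hg.exists_system hU hUs hT
    -- The hypothesis is used on the whole family f̂ + c·f, whose factors are gᵢ + c.
    obtain ⟨i, hi⟩ := hf.exists_index_of_isCyclic hU hg hs hgf fun c => by
      refine h _ ((hg.add_const hU c).isAssociatedSystem hT (hs.add (hT.smooth.const_smul c)) ?_)
      intro p hp i
      have df := GuichardNet.diffAt_of_smooth hU hT.smooth hp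
      rw [GuichardNet.pd_add (GuichardNet.diffAt_of_smooth hU hs hp)
        ((differentiableAt_const c).fun_smul df), GuichardNet.pd_smul (differentiableAt_const c) df,
        GuichardNet.pd_const, zero_smul, zero_add, hgf p hp, add_smul]
    have hij := (GuichardNet.add_one_ne i).symm
    have hik := (GuichardNet.add_two_ne i).symm
    have hjk := (GuichardNet.add_two_ne_add_one i).symm
    refine ⟨i, ?_⟩
    rw [hT.isTotallyUmbilicFamily_iff hU hij hik hjk]
    refine (hf.parallel_or_umbilic hU hUs.isPathConnected.isConnected.isPreconnected hij hik hjk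
      fun p hp => ?_).imp_left (hT.isParallelFamily hU)
    -- Splitting on this factor, which is common to both j ≠ i, gives umbilicity or the vanishing of
    -- both κ_ji together.
    by_cases hp0 : GuichardNet.pd i (g i) p = 0
    · exact Or.inr ((hg.pd_self_eq_zero_iff hU hf hp i).1 hp0)
    · refine Or.inl fun l hl => ?_
      rw [← hT.principalCurvature_eq_zero_iff hU hp hl]
      exact (mul_eq_zero.1 (hi p hp l hl)).resolve_right hp0
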